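/- Let $\mathbb K$ be a field of characteristic zero, $u$ an indeterminate, and let $n,d\ge 1$ be integers. The Rook Yokonuma--Hecke algebra $\mathcal{RY}_{d,n}(u)$ is the unital associative $\mathbb K(u)$-algebra with generators $T_1,\dots,T_{n-1}$, $F_1,\dots,F_n$, $N$ and the following relations, for all indices for which they make sense: \[ \begin{gathered} T_iT_jT_i=T_jT_iT_j\ (|i-j|=1),\qquad T_iT_j=T_jT_i\ (|i-j|>1),\qquad F_i^d=1,\qquad F_iF_j=F_jF_i,\\ T_i^2=u+(u-1)F_i^{\frac{d^2-d}{2}}E_iT_i\ \text{ with }\ E_i=\frac1d\sum_{k=0}^{d-1}F_i^kF_{i+1}^{-k},\qquad T_iF_j=F_{s_i(j)}T_i,\\ F_iN=NF_{i+1}\ (i<n),\qquad NF_1=F_nN=N,\qquad N^{i+1}T_i=uN^{i+1},\qquad T_iN^{n-i+1}=uN^{n-i+1},\\ T_iN=NT_{i+1}\ (i<n-1),\qquad NT_1\cdots T_{n-1}N=u^{n-1}N, \end{gathered} \] where $s_i$ is the transposition $(i\ \,i+1)$. For $1\le j\le k\le n$ put $T_{k,j}=T_{k-1}T_{k-2}\cdots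 T_j$ (so $T_{j,j}=1$). For $A=\{a_1<\dots<a_r\}\subseteq\{1,\dots,n\}$ put $T_A=T_{a_1,1}\cdots T_{a_r,r}$ and $\overline T_A=T_{n-r+1,a_1}\cdots T_{n,a_r}$. For $\mathbf m=(m_1,\dots,m_r)\in(\mathbb Z/d\mathbb Z)^r$ put $F_{\mathbf m}=F_1^{m_1}\cdots F_r^{m_r}$. For $\omega$ in the symmetric group $\mathfrak S_r$ put $T_\omega=T_{i_1}\cdots T_{i_l}$, where $s_{i_1}\cdots s_{i_l}$ is a reduced expression of $\omega$ (by Matsumoto's theorem the choice does not matter). For $0\le r\le n$ let \[ C_{n,r}=\bigl\{\,T_A\,F_{\mathbf m}\,T_\omega\,N^{n-r}\,\overline T_B \;:\; A,B\subseteq\{1,\dots,n\},\ |A|=|B|=r,\ \mathbf m\in(\mathbb Z/d\mathbb Z)^r,\ \omega\in\mathfrak S_r\,\bigr\}, \] so that $C_{n,0}=\{N^n\}$, and let $C_n=\bigcup_{r=0}^nC_{n,r}$. Theorem. The set $C_n$ spans $\mathcal{RY}_{d,n}(u)$ over $\mathbb K(u)$. Consequently $\dim_{\mathbb K(u)}\mathcal{RY}_{d,n}(u)\le|C_n|$.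 Moreover the sets $C_{n,0},\dots,C_{n,n}$ are pairwise disjoint, $|C_{n,r}|=d^r\binom nr^2r!$ for $0\le r\le n$, and hence $C_n$ is finite with $|C_n|=\sum_{r=0}^nd^r\binom nr^2r!$. -/

import Mathlib

noncomputable section

namespace RookYH

/-- Generators, numbered from one: `T_1, …, T_{n-1}`, `F_1, …, F_n` and `N`. -/
inductive Gen (n : ℕ) : Type
  | T (i : ℕ) (hi : 1 ≤ i ∧ i < n) : Gen n
  | F (i : ℕ) (hi : 1 ≤ i ∧ i ≤ n) : Gen n
  | N : Gen n

/-- The free algebra over the field of rational functions `K(u)`; here `u = RatFunc.X`. -/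
abbrev Free (K : Type*) [Field K] (n : ℕ) : Type _ := FreeAlgebra (RatFunc K) (Gen n)

/-- The letter `T_i`. Only the values at `1 ≤ i < n` are ever used. -/
def freeT (K : Type*) [Field K] (n i : ℕ) : Free K n :=
  if hi : 1 ≤ i ∧ i < n then FreeAlgebra.ι (RatFunc K) (Gen.T i hi) else 1

/-- The letter `F_i`. Only the values at `1 ≤ i ≤ n` are ever used. -/
def freeF (K : Type*) [Field K] (n i : ℕ) : Free K n :=
  if hi : 1 ≤ i ∧ i ≤ n then FreeAlgebra.ι (RatFunc K) (Gen.F i hi) else 1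

/-- The letter `N`. -/
def freeN (K : Type*) [Field K] (n : ℕ) : Free K n :=
  FreeAlgebra.ι (RatFunc K) Gen.N

/-- The element `E_i = (1/d) ∑_{k=0}^{d-1} F_i^k F_{i+1}^{-k}`, where `F_{i+1}^{-k}` is written as
`F_{i+1}^{d-k}`, which is the same modulo the relation `F_{i+1}^d = 1`. -/
def freeE (K : Type*) [Field K] (n d i : ℕ) : Free K n :=
  (d : RatFunc K)⁻¹ • ∑ k ∈ Finset.range d, freeF K n i ^ k * freeF K n (i + 1) ^ (d - k)

/-- The defining relations of the Rook Yokonuma--Hecke algebra. -/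
inductive Rel (K : Type*) [Field K] (n d : ℕ) : Free K n → Free K n → Prop
  | braid (i j : ℕ) (hi : 1 ≤ i ∧ i < n) (hj : 1 ≤ j ∧ j < n) (hij : i + 1 = j ∨ j + 1 = i) :
      Rel K n d (freeT K n i * freeT K n j * freeT K n i) (freeT K n j * freeT K n i * freeT K n j)
  | comm (i j : ℕ) (hi : 1 ≤ i ∧ i < n) (hj : 1 ≤ j ∧ j < n) (hij : i + 1 < j ∨ j + 1 < i) :
      Rel K n d (freeT K n i * freeT K n j) (freeT K n j * freeT K n i)
  | F_pow (i : ℕ) (hi : 1 ≤ i ∧ i ≤ n) :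
      Rel K n d (freeF K n i ^ d) 1
  | F_comm (i j : ℕ) (hi : 1 ≤ i ∧ i ≤ n) (hj : 1 ≤ j ∧ j ≤ n) :
      Rel K n d (freeF K n i * freeF K n j) (freeF K n j * freeF K n i)
  | quadratic (i : ℕ) (hi : 1 ≤ i ∧ i < n) :
      Rel K n d (freeT K n i ^ 2)
        (algebraMap (RatFunc K) (Free K n) RatFunc.X
          + ((RatFunc.X : RatFunc K) - 1) •
              (freeF K n i ^ ((d ^ 2 - d) / 2) * freeE K n d i * freeT K n i))
  | T_F (i j : ℕ) (hi : 1 ≤ i ∧ i < n) (hj : 1 ≤ j ∧ j ≤ n) :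
      Rel K n d (freeT K n i * freeF K n j) (freeF K n (Equiv.swap i (i + 1) j) * freeT K n i)
  | F_N (i : ℕ) (hi : 1 ≤ i ∧ i < n) :
      Rel K n d (freeF K n i * freeN K n) (freeN K n * freeF K n (i + 1))
  | N_F_one :
      Rel K n d (freeN K n * freeF K n 1) (freeN K n)
  | F_last_N :
      Rel K n d (freeF K n n * freeN K n) (freeN K n)
  | N_pow_T (i : ℕ) (hi : 1 ≤ i ∧ i < n) :
      Rel K n d (freeN K n ^ (i + 1) * freeT K n i)
        ((RatFunc.X : RatFunc K) • freeN K n ^ (i + 1))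
  | T_N_pow (i : ℕ) (hi : 1 ≤ i ∧ i < n) :
      Rel K n d (freeT K n i * freeN K n ^ (n - i + 1))
        ((RatFunc.X : RatFunc K) • freeN K n ^ (n - i + 1))
  | T_N (i : ℕ) (hi : 1 ≤ i ∧ i + 1 < n) :
      Rel K n d (freeT K n i * freeN K n) (freeN K n * freeT K n (i + 1))
  | N_T_N :
      Rel K n d (freeN K n * ((List.range' 1 (n - 1)).map (freeT K n)).prod * freeN K n)
        ((RatFunc.X : RatFunc K) ^ (n - 1) • freeN K n)

/-- The Rook Yokonuma--Hecke algebra over `K(u)`. -/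
abbrev RY (K : Type*) [Field K] (n d : ℕ) : Type _ := RingQuot (Rel K n d)

/-- The generator `T_i` of the Rook Yokonuma--Hecke algebra (`1 ≤ i < n`). -/
def T (K : Type*) [Field K] (n d i : ℕ) : RY K n d :=
  RingQuot.mkAlgHom (RatFunc K) (Rel K n d) (freeT K n i)

/-- The generator `F_i` of the Rook Yokonuma--Hecke algebra (`1 ≤ i ≤ n`). -/
def F (K : Type*) [Field K] (n d i : ℕ) : RY K n d :=
  RingQuot.mkAlgHom (RatFunc K) (Rel K n d) (freeF K n i)

/-- The generator `N` of the Rook Yokonuma--Hecke algebra. -/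
def N (K : Type*) [Field K] (n d : ℕ) : RY K n d :=
  RingQuot.mkAlgHom (RatFunc K) (Rel K n d) (freeN K n)

/-- `T_{k,j} = T_{k-1} T_{k-2} ⋯ T_j` for `j ≤ k`; it is `1` if `k = j`. -/
def Tseg (K : Type*) [Field K] (n d k j : ℕ) : RY K n d :=
  ((List.range' j (k - j)).reverse.map (T K n d)).prod

/-- `T_A = T_{a_1,1} ⋯ T_{a_k,k}` for `A = {a_1 < ⋯ < a_k} ⊆ {1, …, n}`. -/
def TA (K : Type*) [Field K] (n d : ℕ) (A : Finset ℕ) : RY K n d :=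
  (List.ofFn fun i : Fin A.card => Tseg K n d (A.orderEmbOfFin rfl i) (i + 1)).prod

/-- `T̄_A = T_{n-k+1,a_1} ⋯ T_{n,a_k}` for `A = {a_1 < ⋯ < a_k} ⊆ {1, …, n}`. -/
def TAbar (K : Type*) [Field K] (n d : ℕ) (A : Finset ℕ) : RY K n d :=
  (List.ofFn fun i : Fin A.card =>
    Tseg K n d (n - A.card + (i + 1)) (A.orderEmbOfFin rfl i)).prod

/-- `F_m = F_1^{m_1} ⋯ F_r^{m_r}` for `m ∈ (ℤ/d)^r`. -/
def Fm (K : Type*) [Field K] (n d : ℕ) {r : ℕ} (m : Fin r → ZMod d) : RY K n d :=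
  (List.ofFn fun i : Fin r => F K n d (i + 1) ^ (m i).val).prod

/-- The simple transpositions of the symmetric group `S_r`; the value at `i` is the one usually
written `s_{i+1}`, because `Fin (r - 1)` and `Fin r` are numbered from zero. -/
def simple (r : ℕ) (i : Fin (r - 1)) : Equiv.Perm (Fin r) :=
  Equiv.swap ⟨i, by omega⟩ ⟨i + 1, by omega⟩

/-- The word `l` in the simple transpositions is a reduced expression for `ω`. (Whether
permutations are composed from the left or from the right does not affect the set of all
`T_ω`, since this only exchanges `ω` and `ω⁻¹`.) -/
def IsReducedExpr {r : ℕ} (ω : Equiv.Perm (Fin r)) (l : List (Fin (r - 1))) : Prop :=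
  (l.map (simple r)).prod = ω ∧
    ∀ l' : List (Fin (r - 1)), (l'.map (simple r)).prod = ω → l.length ≤ l'.length

theorem exists_isReducedExpr {r : ℕ} (ω : Equiv.Perm (Fin r)) :
    ∃ l : List (Fin (r - 1)), IsReducedExpr ω l := by
  have hne : {l : List (Fin (r - 1)) | (l.map (simple r)).prod = ω}.Nonempty := by
    cases r with
    | zero => exact ⟨[], Subsingleton.elim _ _⟩
    | succ r =>
      have h : ω ∈ Submonoid.closure
          (Set.range fun i : Fin r => Equiv.swap i.castSucc i.succ) := by
        rw [Equiv.Perm.mclosure_swap_castSucc_succ]; trivial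
      induction h using Submonoid.closure_induction with
      | mem x hx =>
        obtain ⟨i, rfl⟩ := hx
        refine ⟨[i], ?_⟩
        simp only [Set.mem_ofPred_eq, List.map_cons, List.map_nil, List.prod_cons, List.prod_nil,
          mul_one]
        rfl
      | one => exact ⟨[], rfl⟩
      | mul x y _ _ hx hy =>
        obtain ⟨a, ha⟩ := hx
        obtain ⟨b, hb⟩ := hy
        refine ⟨a ++ b, ?_⟩
        simp only [Set.mem_ofPred_eq] at ha hb ⊢
        rw [List.map_append, List.prod_append, ha, hb]
  refine ⟨Function.argminOn List.length _ hne, Function.argminOn_mem List.length _ hne, ?_⟩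
  intro l' hl'
  exact not_lt.mp (Function.not_lt_argminOn List.length _ hl')

/-- `T_ω = T_{i_1} ⋯ T_{i_l}` for a reduced expression `s_{i_1} ⋯ s_{i_l}` of `ω ∈ S_r`. -/
def Tperm (K : Type*) [Field K] (n d : ℕ) {r : ℕ} (ω : Equiv.Perm (Fin r)) : RY K n d :=
  ((exists_isReducedExpr ω).choose.map fun i => T K n d (i + 1)).prod

/-- The set `C_{n,r}` of all `T_A F_m T_ω N^{n-r} T̄_B` with `A, B ⊆ {1, …, n}`,
`|A| = |B| = r`, `m ∈ (ℤ/d)^r`, `ω ∈ S_r`. -/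
def Cr (K : Type*) [Field K] (n d r : ℕ) : Set (RY K n d) :=
  {x | ∃ A B : Finset ℕ, A ⊆ Finset.Icc 1 n ∧ B ⊆ Finset.Icc 1 n ∧ A.card = r ∧ B.card = r ∧
    ∃ (m : Fin r → ZMod d) (ω : Equiv.Perm (Fin r)),
      x = TA K n d A * Fm K n d m * Tperm K n d ω * N K n d ^ (n - r) * TAbar K n d B}

/-- The set `C_n`, the union of the `C_{n,r}` with `0 ≤ r ≤ n`. -/
def C (K : Type*) [Field K] (n d : ℕ) : Set (RY K n d) :=
  ⋃ r ∈ Finset.range (n + 1), Cr K n d r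

/-- For `r = 0` the general description gives the single element `N^n`. -/
theorem Cr_zero (K : Type*) [Field K] (n d : ℕ) : Cr K n d 0 = {N K n d ^ n} := by
  have key : ∀ (m : Fin 0 → ZMod d) (ω : Equiv.Perm (Fin 0)),
      TA K n d ∅ * Fm K n d m * Tperm K n d ω * N K n d ^ (n - 0) * TAbar K n d ∅
        = N K n d ^ n := by
    intro m ω
    have hl : (exists_isReducedExpr ω).choose = [] := by
      rcases h : (exists_isReducedExpr ω).choose with _ | ⟨a, _⟩
      · rfl
      · exact a.elim0
    simp [TA, TAbar, Fm, Tperm, hl]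
  ext x
  constructor
  · rintro ⟨A, B, -, -, hA, hB, m, ω, rfl⟩
    rw [Finset.card_eq_zero] at hA hB
    subst hA hB
    exact key m ω
  · rintro rfl
    exact ⟨∅, ∅, by simp, by simp, rfl, rfl, Fin.elim0, 1, (key _ _).symm⟩

end RookYH

end

/-! Spanning. Let H be the subalgebra generated by the T_i and F_j. The span of all products x N^m
x' with x, x' in H and m ≤ n contains 1 and is a left ideal, so it is the whole algebra. The only
question is left multiplication by N. Write x as a sum of terms y T_1⋯T_b with y generated by the
F_j and by the T_i with i ≥ 2. Such a y moves to the left of N, and N T_1⋯T_b N^m reduces: T_1⋯T_b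
passes through N^m when b < n - m, letters T_i with i > n - m become factors u, and N T_1⋯T_{n-m}
N^m = u^{n-m} N^m (`N_mul_ascending_mul_pow`, `N_mul_mem_sandwich`).

In x N^m x' put r = n - m. The generators T_j, F_j with j > r commute with H_r, the subalgebra
belonging to the first r indices, and act on N^m by scalars. So H N^m is the sum of the T_A H_r N^m,
where the T_A play the part of minimal coset representatives (`mul_lowProd`,
`mul_mem_span_lowProd`). The anti-symmetry T_i ↦ T_{n-i}, F_i ↦ F_{n+1-i}, N ↦ N gives the mirrored
statement on the right. Finally H_r is spanned by framing elements times one fixed reduced word for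
each permutation, and these words give exactly the T_ω (`exists_Tperm_eq`).

Counting. Pairwise distinctness of the listed elements is enough; linear independence is not needed.
The algebra acts on functions of words x_1, x_2, … whose letters are natural numbers. Each letter a
has a colour c(a) with c(a)^d = 1, and the letter 0 means an empty place and has colour 1. T_i acts
as a deformed swap of places, F_i multiplies by the colour of x_i, and N tests the last colour,
shifts the word and inserts 0. At u = 1 the T_i become honest transpositions of places. A standard
element, evaluated at the word 1, 2, …, n, then returns a monomial in the colours times the value at
the word that has a_{ω(i)} at place b_i and zeros elsewhere. This word is a partial permutation and
determines A, B and ω. Giving one letter of A a primitive d-th root of unity as colour, over an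
algebraic closure, recovers the exponents. -/

namespace RookYH

/-! ### Braid words and coset representatives -/

section BraidWords

variable {M : Type*} [Monoid M]

/-- The descending product `t_{k-1} t_{k-2} ⋯ t_j`. -/
def seg (t : ℕ → M) (k j : ℕ) : M := ((List.range' j (k - j)).reverse.map t).prod

/-- Elements `t_1, …, t_{n-1}` of a monoid that satisfy the braid relations of type A. -/
structure IsBraid (n : ℕ) (t : ℕ → M) : Prop where
  braid : ∀ i, 1 ≤ i → i + 1 < n → t i * t (i + 1) * t i = t (i + 1) * t i * t (i + 1)
  comm : ∀ i j, 1 ≤ i → i + 1 < j → j < n → t i * t j = t j * t i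

theorem IsBraid.mono {n m : ℕ} {t : ℕ → M} (h : IsBraid n t) (hm : m ≤ n) : IsBraid m t :=
  ⟨fun i hi hn => h.braid i hi (by omega), fun i j hi hij hj => h.comm i j hi hij (by omega)⟩

theorem IsBraid.prod {M' : Type*} [Monoid M'] {n : ℕ} {t : ℕ → M} {s : ℕ → M'}
    (h : IsBraid n t) (h' : IsBraid n s) : IsBraid n fun i => (t i, s i) :=
  ⟨fun i hi hn => Prod.ext (h.braid i hi hn) (h'.braid i hi hn),
    fun i j hi hij hj => Prod.ext (h.comm i j hi hij hj) (h'.comm i j hi hij hj)⟩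

theorem IsBraid.op {n : ℕ} {t : ℕ → M} (h : IsBraid n t) :
    IsBraid n fun i => MulOpposite.op (t i) :=
  ⟨fun i hi hn => by
    have := h.braid i hi hn
    simp only [← MulOpposite.op_mul, ← mul_assoc, this],
   fun i j hi hij hj => by
    simp only [← MulOpposite.op_mul, h.comm i j hi hij hj]⟩

theorem IsBraid.rev {n : ℕ} {t : ℕ → M} (h : IsBraid n t) : IsBraid n fun i => t (n - i) :=
  ⟨fun i hi hn => by
    have := h.braid (n - (i + 1)) (by omega) (by omega)
    rw [show n - (i + 1) + 1 = n - i by omega] at this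
    exact this.symm,
   fun i j hi hij hj => (h.comm (n - j) (n - i) (by omega) (by omega) (by omega)).symm⟩

@[simp] theorem seg_self (t : ℕ → M) (j : ℕ) : seg t j j = 1 := by simp [seg]

theorem seg_succ (t : ℕ → M) {k j : ℕ} (h : j ≤ k) : seg t (k + 1) j = t k * seg t k j := by
  have : k + 1 - j = (k - j) + 1 := by omega
  rw [seg, seg, this, List.range'_1_concat]
  simp [show j + (k - j) = k by omega]

theorem seg_succ_right (t : ℕ → M) {k j : ℕ} (h : j < k) :
    seg t k j = seg t k (j + 1) * t j := by
  have : k - j = (k - (j + 1)) + 1 := by omega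
  rw [seg, seg, this, List.range'_succ]
  simp

variable {n : ℕ} {t : ℕ → M}

theorem IsBraid.commute (h : IsBraid n t) {i j : ℕ} (hi : 1 ≤ i) (hj : 1 ≤ j) (hin : i < n)
    (hjn : j < n) (hij : i + 1 < j ∨ j + 1 < i) : Commute (t i) (t j) := by
  rcases hij with hij | hij
  · exact h.comm i j hi hij hjn
  · exact (h.comm j i hj hij hin).symm

theorem commute_seg {x : M} {k j : ℕ} (h : ∀ i, j ≤ i → i < k → Commute x (t i)) :
    Commute x (seg t k j) := by
  refine Commute.list_prod_right _ _ fun y hy => ?_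
  simp only [List.map_reverse, List.mem_reverse, List.mem_map, List.mem_range'_1] at hy
  obtain ⟨i, hi, rfl⟩ := hy
  exact h i hi.1 (by omega)

theorem IsBraid.commute_seg_of_lt (h : IsBraid n t) {i k j : ℕ} (hj : 1 ≤ j) (hki : k < i)
    (hi : i < n) : Commute (t i) (seg t k j) :=
  commute_seg fun l hl hl' => h.commute (by omega) (by omega) hi (by omega) (Or.inr (by omega))

theorem IsBraid.commute_seg_of_gt (h : IsBraid n t) {i k j : ℕ} (hi : 1 ≤ i) (hij : i + 1 < j)
    (hk : k ≤ n) : Commute (t i) (seg t k j) :=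
  commute_seg fun l hl hl' => h.commute hi (by omega) (by omega) (by omega) (Or.inl (by omega))

/-- A descending product is a long cycle, and conjugation by it shifts the generators in its
interior by one. The braid relation is used once, where `t i` meets `t (i + 1) * t i`; all other
letters commute with what they pass. -/
theorem IsBraid.mul_seg (h : IsBraid n t) {i k j : ℕ} (hj : 1 ≤ j) (hji : j ≤ i) (hik : i + 1 < k)
    (hk : k ≤ n) : t i * seg t k j = seg t k j * t (i + 1) := by
  induction k, (show i + 2 ≤ k from hik) using Nat.le_induction with
  | base =>
    have hc := h.commute_seg_of_lt (i := i + 1) (k := i) hj (by omega) (by omega)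
    rw [show i + 2 = i + 1 + 1 from rfl, seg_succ t (by omega : j ≤ i + 1), seg_succ t hji,
      ← mul_assoc, ← mul_assoc, h.braid i (by omega) (by omega), mul_assoc, hc.eq]
    simp only [mul_assoc]
  | succ m hm ih =>
    rw [seg_succ t (by omega), ← mul_assoc,
      (h.commute (j := m) (by omega : 1 ≤ i) (by omega) (by omega) (by omega)
        (Or.inl (by omega))).eq, mul_assoc, ih (by omega) (by omega), mul_assoc]

/-- The two segments carry two neighbouring strands in parallel past the same `a - j` strands; a
crossing of the two slides from one end to the other. -/
theorem IsBraid.mul_seg_mul_seg (h : IsBraid n t) {a j : ℕ} (hj : 1 ≤ j) (hja : j ≤ a)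
    (ha : a < n) :
    t a * (seg t a j * seg t (a + 1) (j + 1)) = seg t a j * seg t (a + 1) (j + 1) * t j := by
  induction a, hja using Nat.le_induction with
  | base => simp
  | succ a hja ih =>
    have hc := (h.commute_seg_of_lt (i := a + 1) (k := a) hj (by omega) (by omega)).eq
    have e : seg t (a + 1) j * seg t (a + 1 + 1) (j + 1)
        = t a * t (a + 1) * (seg t a j * seg t (a + 1) (j + 1)) := by
      rw [seg_succ t hja, seg_succ t (by omega : j + 1 ≤ a + 1)]
      calc t a * seg t a j * (t (a + 1) * seg t (a + 1) (j + 1))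
          = t a * (seg t a j * t (a + 1)) * seg t (a + 1) (j + 1) := by simp only [mul_assoc]
        _ = _ := by rw [← hc]; simp only [mul_assoc]
    rw [e, ← mul_assoc, ← mul_assoc (t (a + 1)), ← h.braid a (by omega) ha, mul_assoc,
      ih (by omega)]
    simp only [mul_assoc]

/-- The product `t_{a_1,k+1} t_{a_2,k+2} ⋯` for a list `a_1, a_2, …`. -/
def lowProd (t : ℕ → M) : ℕ → List ℕ → M
  | _, [] => 1
  | k, a :: as => seg t a (k + 1) * lowProd t (k + 1) as

/-- The product `t_{k+1,b_1} t_{k+2,b_2} ⋯` for a list `b_1, b_2, …`. -/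
def highProd (t : ℕ → M) : ℕ → List ℕ → M
  | _, [] => 1
  | k, b :: bs => seg t (k + 1) b * highProd t (k + 1) bs

/-- The list is strictly increasing with entries in `{m + 1, …, n}`. -/
def IncrIn (m n : ℕ) (as : List ℕ) : Prop := as.Pairwise (· < ·) ∧ ∀ a ∈ as, m < a ∧ a ≤ n

theorem IncrIn.cons_iff {m n a : ℕ} {as : List ℕ} :
    IncrIn m n (a :: as) ↔ m < a ∧ a ≤ n ∧ IncrIn a n as := by
  simp only [IncrIn, List.pairwise_cons, List.mem_cons, forall_eq_or_imp]
  constructor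
  · rintro ⟨⟨h1, h2⟩, h3, h4⟩
    exact ⟨h3.1, h3.2, h2, fun b hb => ⟨h1 b hb, (h4 b hb).2⟩⟩
  · rintro ⟨h1, h2, h3, h4⟩
    exact ⟨⟨fun b hb => (h4 b hb).1, h3⟩, ⟨h1, h2⟩,
      fun b hb => ⟨h1.trans (h4 b hb).1, (h4 b hb).2⟩⟩

theorem IncrIn.mono {m m' n : ℕ} {as : List ℕ} (h : IncrIn m n as) (hm : m' ≤ m) :
    IncrIn m' n as :=
  ⟨h.1, fun a ha => ⟨hm.trans_lt (h.2 a ha).1, (h.2 a ha).2⟩⟩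

theorem IncrIn.length_le {m n : ℕ} {as : List ℕ} (h : IncrIn m n as) :
    as.length ≤ n - m := by
  induction as generalizing m with
  | nil => simp
  | cons a as ih =>
    obtain ⟨h1, h2, h3⟩ := IncrIn.cons_iff.1 h
    have := ih h3
    simp only [List.length_cons]
    omega

theorem IsBraid.commute_lowProd (h : IsBraid n t) {i k : ℕ} (hi : 1 ≤ i) (hik : i < k)
    {as : List ℕ} (has : IncrIn k n as) : Commute (t i) (lowProd t k as) := by
  induction as generalizing k with
  | nil => exact Commute.one_right _
  | cons a as ih =>
    obtain ⟨h1, h2, h3⟩ := IncrIn.cons_iff.1 has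
    exact (h.commute_seg_of_gt hi (by omega) h2).mul_right (ih (by omega) (h3.mono h1))

theorem IsBraid.mul_lowProd_of_lt (h : IsBraid n t) {i k : ℕ} (hik : k < i) {as : List ℕ}
    (has : IncrIn (i + 1) n as) : t i * lowProd t k as = lowProd t k as * t (i + as.length) := by
  induction as generalizing k i with
  | nil => simp [lowProd]
  | cons a as ih =>
    obtain ⟨h1, h2, h3⟩ := IncrIn.cons_iff.1 has
    rw [lowProd, ← mul_assoc, h.mul_seg (by omega) (by omega) h1 h2, mul_assoc,
      ih (by omega) (h3.mono h1), ← mul_assoc, List.length_cons]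
    congr 2; omega

/-- Left multiplication of `t_{a_1,k+1} t_{a_2,k+2} ⋯` by a generator. -/
theorem IsBraid.mul_lowProd (h : IsBraid n t) {i k m : ℕ} (hkm : k ≤ m) (hmi : m < i) (hin : i < n)
    {as : List ℕ} (has : IncrIn m n as) :
    (∃ j, k < j ∧ j < n ∧ j ≠ k + as.length ∧ t i * lowProd t k as = lowProd t k as * t j) ∨
    (∃ as', IncrIn m n as' ∧ as'.length = as.length ∧ t i * lowProd t k as = lowProd t k as') ∨
    (∃ as', IncrIn m n as' ∧ as'.length = as.length ∧ lowProd t k as = t i * lowProd t k as') := by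
  induction as generalizing k m with
  | nil => exact Or.inl ⟨i, by omega, hin, by simp; omega, by simp [lowProd]⟩
  | cons a as ih =>
    obtain ⟨h1, h2, h3⟩ := IncrIn.cons_iff.1 has
    rcases lt_trichotomy i a with hia | rfl | hia
    · rcases Nat.lt_or_ge (i + 1) a with hia' | hia'
      · have hlen := (has.mono (m' := m) le_rfl).length_le
        have hl : IncrIn (i + 1) n (a :: as) := IncrIn.cons_iff.2 ⟨hia', h2, h3⟩
        have := hl.length_le
        refine Or.inl ⟨i + (a :: as).length, by omega, by omega, by omega, ?_⟩
        exact h.mul_lowProd_of_lt (by omega) hl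
      -- Here multiplication by `t i` undoes the first letter. Without inverses this can only be
      -- recorded as an equation for the old product in terms of the new one; the quadratic relation
      -- is applied later.
      · obtain rfl : a = i + 1 := by omega
        refine Or.inr (Or.inr ⟨i :: as, IncrIn.cons_iff.2 ⟨hmi, by omega, h3.mono (by omega)⟩,
          rfl, ?_⟩)
        rw [lowProd, lowProd, seg_succ t (by omega), mul_assoc]
    · cases as with
      | nil =>
        refine Or.inr (Or.inl ⟨[i + 1], IncrIn.cons_iff.2 ⟨by omega, by omega, ?_⟩, rfl, ?_⟩)
        · simp [IncrIn]
        · simp only [lowProd, seg_succ t (by omega : k + 1 ≤ i), mul_assoc]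
      | cons b bs =>
        obtain ⟨g1, g2, g3⟩ := IncrIn.cons_iff.1 h3
        rcases Nat.lt_or_ge (i + 1) b with hb | hb
        · refine Or.inr (Or.inl ⟨(i + 1) :: b :: bs, IncrIn.cons_iff.2 ⟨by omega, by omega,
            IncrIn.cons_iff.2 ⟨hb, g2, g3⟩⟩, rfl, ?_⟩)
          simp only [lowProd, seg_succ t (by omega : k + 1 ≤ i), mul_assoc]
        -- Both `i` and `i + 1` are entries: the crossing slides through the two parallel segments
        -- and emerges as `t (k + 1)`, which commutes with the remaining ones.
        · obtain rfl : b = i + 1 := by omega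
          refine Or.inl ⟨k + 1, by omega, by omega, by simp, ?_⟩
          have hc := h.commute_lowProd (i := k + 1) (k := k + 2) (by omega) (by omega)
            (g3.mono (by omega))
          rw [lowProd, lowProd]
          calc t i * (seg t i (k + 1) * (seg t (i + 1) (k + 1 + 1) * lowProd t (k + 1 + 1) bs))
              = t i * (seg t i (k + 1) * seg t (i + 1) (k + 1 + 1)) * lowProd t (k + 1 + 1) bs := by
                simp only [mul_assoc]
            _ = _ := by
                rw [h.mul_seg_mul_seg (by omega) (by omega) hin, mul_assoc, hc.eq]
                simp only [mul_assoc]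
    · have hc := h.commute_seg_of_lt (i := i) (k := a) (j := k + 1) (by omega) hia hin
      rw [lowProd, ← mul_assoc, hc.eq, mul_assoc]
      rcases ih (k := k + 1) (m := a) (by omega) hia h3 with
        ⟨j, h4, h5, h6, h7⟩ | ⟨as', h4, h5, h6⟩ | ⟨as', h4, h5, h6⟩
      · refine Or.inl ⟨j, by omega, h5, by simp only [List.length_cons]; omega, ?_⟩
        rw [h7, mul_assoc]
      · refine Or.inr (Or.inl ⟨a :: as', IncrIn.cons_iff.2 ⟨h1, h2, h4⟩, by simp [h5], ?_⟩)
        rw [h6, lowProd]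
      · refine Or.inr (Or.inr ⟨a :: as', IncrIn.cons_iff.2 ⟨h1, h2, h4⟩, by simp [h5], ?_⟩)
        rw [h6, lowProd, ← mul_assoc, ← hc.eq, mul_assoc]

/-! ### Normal forms in the symmetric group -/

/-- The words `w_1 ⋯ w_r` with `w_k` descending from `k - 1`: one reduced word for every element
of the symmetric group on `r` letters. -/
def normalForms : ℕ → Finset (List ℕ)
  | 0 => {[]}
  | r + 1 => (normalForms r ×ˢ Finset.Icc 1 (r + 1)).image
      fun p => p.1 ++ (List.range' p.2 (r + 1 - p.2)).reverse

/-- The upper bound suffices: in `exists_Tperm_eq` the symmetric group is injected into the set of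
normal forms. -/
theorem card_normalForms_le (r : ℕ) : (normalForms r).card ≤ r.factorial := by
  induction r with
  | zero => simp [normalForms]
  | succ r ih =>
    refine Finset.card_image_le.trans ?_
    rw [Finset.card_product, Nat.card_Icc, Nat.factorial_succ, mul_comm]
    simpa using Nat.mul_le_mul_left (r + 1) ih

theorem nil_mem_normalForms (r : ℕ) : [] ∈ normalForms r := by
  induction r with
  | zero => simp [normalForms]
  | succ r ih =>
    exact Finset.mem_image.2 ⟨([], r + 1), by simp [ih], by simp⟩

theorem mem_of_mem_normalForms {r : ℕ} {w : List ℕ} (hw : w ∈ normalForms r) {i : ℕ}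
    (hi : i ∈ w) : 1 ≤ i ∧ i < r := by
  induction r generalizing w with
  | zero => simp [normalForms] at hw; simp [hw] at hi
  | succ r ih =>
    obtain ⟨⟨v, a⟩, hp, rfl⟩ := Finset.mem_image.1 hw
    simp only [Finset.mem_product, Finset.mem_Icc, List.mem_append, List.mem_reverse,
      List.mem_range'_1] at hp hi
    rcases hi with hi | hi
    · have := ih hp.1 hi; omega
    · omega

/-- The product of the letters of a word. -/
def wordProd (t : ℕ → M) (w : List ℕ) : M := (w.map t).prod

theorem wordProd_append (t : ℕ → M) (v w : List ℕ) :
    wordProd t (v ++ w) = wordProd t v * wordProd t w := by simp [wordProd]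

/-- The exchange property in a form that needs only braid relations: the shortening case is stated
as a factorization, so neither `t i * t i = 1` nor a quadratic relation enters. Against the last
descending factor, which ends in `a`, a generator with `i < a - 1` commutes, `i = a - 1` lengthens
it, `i = a` shortens it, and `i > a` passes through as `i - 1`. In the first and last case induction
applies to the rest of the word. -/
theorem IsBraid.normalForms_mul (h : IsBraid n t) {r : ℕ} (hr : r ≤ n) {w : List ℕ}
    (hw : w ∈ normalForms r) {i : ℕ} (hi : 1 ≤ i) (hir : i < r) :
    ∃ w' ∈ normalForms r,
      (w'.length = w.length + 1 ∧ wordProd t w * t i = wordProd t w') ∨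
      (w.length = w'.length + 1 ∧ wordProd t w = wordProd t w' * t i) := by
  induction r generalizing w i with
  | zero => omega
  | succ r ih =>
    obtain ⟨⟨v, a⟩, hp, rfl⟩ := Finset.mem_image.1 hw
    simp only [Finset.mem_product, Finset.mem_Icc] at hp
    obtain ⟨hv, ha, har⟩ := hp
    have mem : ∀ v' b, v' ∈ normalForms r → 1 ≤ b → b ≤ r + 1 →
        v' ++ (List.range' b (r + 1 - b)).reverse ∈ normalForms (r + 1) := fun v' b h1 h2 h3 =>
      Finset.mem_image.2 ⟨(v', b), by simp [h1, h2, h3], rfl⟩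
    have ev : ∀ v' b, wordProd t (v' ++ (List.range' b (r + 1 - b)).reverse)
        = wordProd t v' * seg t (r + 1) b := fun v' b => wordProd_append _ _ _
    have move : ∀ i', 1 ≤ i' → i' < r → t i' * seg t (r + 1) a = seg t (r + 1) a * t i →
        ∃ w' ∈ normalForms (r + 1),
          (w'.length = (v ++ (List.range' a (r + 1 - a)).reverse).length + 1 ∧
            wordProd t (v ++ (List.range' a (r + 1 - a)).reverse) * t i = wordProd t w') ∨
          ((v ++ (List.range' a (r + 1 - a)).reverse).length = w'.length + 1 ∧
            wordProd t (v ++ (List.range' a (r + 1 - a)).reverse) = wordProd t w' * t i) := by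
      intro i' h1 h2 h3
      obtain ⟨v', hv', ⟨h4, h5⟩ | ⟨h4, h5⟩⟩ := ih (by omega) hv h1 h2
      · refine ⟨_, mem v' a hv' ha har, Or.inl ⟨by simp [h4]; omega, ?_⟩⟩
        rw [ev, ev, mul_assoc, ← h3, ← mul_assoc, h5]
      · refine ⟨_, mem v' a hv' ha har, Or.inr ⟨by simp [h4]; omega, ?_⟩⟩
        rw [ev, ev, mul_assoc, ← h3, ← mul_assoc, h5]
    rcases lt_trichotomy i a with hia | rfl | hia
    · rcases Nat.lt_or_ge (i + 1) a with hia' | hia'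
      · exact move i hi (by omega) (h.commute_seg_of_gt hi hia' hr).eq
      · obtain rfl : a = i + 1 := by omega
        refine ⟨_, mem v i hv hi (by omega), Or.inl ⟨by simp; omega, ?_⟩⟩
        rw [ev, ev, seg_succ_right t (by omega : i < r + 1), mul_assoc]
    · refine ⟨_, mem v (i + 1) hv (by omega) (by omega), Or.inr ⟨by simp; omega, ?_⟩⟩
      rw [ev, ev, seg_succ_right t (by omega : i < r + 1), mul_assoc]
    · obtain ⟨i, rfl⟩ : ∃ i', i = i' + 1 := ⟨i - 1, by omega⟩
      exact move i (by omega) (by omega) (h.mul_seg ha (by omega) (by omega) hr)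

/-- A substitute for Matsumoto's theorem. The word is normalized letter by letter in the product
monoid `M × G`, so that the same normal form serves both components. A shortening step uses `s i * s
i = 1` and is valid only in `G`; if the final length equals the original one, no such step occurred
and the equality holds in `M` too. -/
theorem IsBraid.exists_normalForm (h : IsBraid n t) {G : Type*} [Group G] {s : ℕ → G}
    (hs : IsBraid n s) (hs2 : ∀ i, 1 ≤ i → i < n → s i * s i = 1) (l : List ℕ)
    (hl : ∀ i ∈ l, 1 ≤ i ∧ i < n) :
    ∃ w ∈ normalForms n, w.length ≤ l.length ∧ wordProd s w = wordProd s l ∧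
      (w.length = l.length → wordProd t w = wordProd t l) := by
  have hfst : ∀ w, (wordProd (fun i => (t i, s i)) w).1 = wordProd t w := fun w => by
    induction w with
    | nil => rfl
    | cons a w ih => simpa [wordProd] using congrArg (t a * ·) ih
  have hsnd : ∀ w, (wordProd (fun i => (t i, s i)) w).2 = wordProd s w := fun w => by
    induction w with
    | nil => rfl
    | cons a w ih => simpa [wordProd] using congrArg (s a * ·) ih
  induction l using List.reverseRecOn with
  | nil => exact ⟨[], nil_mem_normalForms n, le_rfl, rfl, fun _ => rfl⟩
  | append_singleton l i ih =>
    obtain ⟨w, hw, h1, h2, h3⟩ := ih fun j hj => hl j (by simp [hj])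
    obtain ⟨hi, hin⟩ := hl i (by simp)
    have hcat : wordProd t (l ++ [i]) = wordProd t l * t i := by simp [wordProd]
    have hcat' : wordProd s (l ++ [i]) = wordProd s l * s i := by simp [wordProd]
    obtain ⟨w', hw', ⟨h4, h5⟩ | ⟨h4, h5⟩⟩ := (h.prod hs).normalForms_mul le_rfl hw hi hin
    · have h5t := congrArg Prod.fst h5
      have h5s := congrArg Prod.snd h5
      simp only [Prod.fst_mul, Prod.snd_mul, hfst, hsnd] at h5t h5s
      refine ⟨w', hw', by simp; omega, by rw [hcat', ← h2, h5s], fun h6 => ?_⟩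
      rw [hcat, ← h5t, h3 (by simp at h6; omega)]
    · have h5s := congrArg Prod.snd h5
      simp only [Prod.snd_mul, hsnd] at h5s
      refine ⟨w', hw', by simp; omega, ?_, fun h6 => by simp at h6; omega⟩
      rw [hcat', ← h2, h5s, mul_assoc, hs2 i hi hin, mul_one]

end BraidWords
-- Straightening in the Yokonuma–Hecke subalgebra
open MulOpposite

section YokonumaHecke

variable {k A : Type*} [Field k] [Ring A] [Algebra k A]

/-- The subalgebra generated by `f_1, …, f_r`. -/
abbrev framing (k : Type*) {A : Type*} [Field k] [Ring A] [Algebra k A] (f : ℕ → A) (r : ℕ) :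
    Subalgebra k A :=
  Algebra.adjoin k (f '' Set.Icc 1 r)

/-- The subalgebra generated by `t_1, …, t_{r-1}` and `f_1, …, f_r`. -/
abbrev hecke (k : Type*) {A : Type*} [Field k] [Ring A] [Algebra k A] (t f : ℕ → A) (r : ℕ) :
    Subalgebra k A :=
  Algebra.adjoin k (t '' Set.Ico 1 r ∪ f '' Set.Icc 1 r)

/-- Elements `t_1, …, t_{n-1}` and `f_1, …, f_n` that satisfy the relations of the Yokonuma--Hecke
algebra, in the form needed for straightening. -/
structure IsYokonumaHecke (n : ℕ) (u : k) (t f : ℕ → A) : Prop extends IsBraid n t where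
  f_comm : ∀ i j, 1 ≤ i → i ≤ n → 1 ≤ j → j ≤ n → Commute (f i) (f j)
  t_f : ∀ i j, 1 ≤ i → i < n → 1 ≤ j → j ≤ n → t i * f j = f (Equiv.swap i (i + 1) j) * t i
  quad : ∀ i, 1 ≤ i → i < n →
    ∃ g ∈ Algebra.adjoin k {f i, f (i + 1)}, t i * t i = algebraMap k A u + g * t i

theorem swap_mem_Icc {i j r : ℕ} (hi : 1 ≤ i) (hir : i < r) (hj : 1 ≤ j) (hjr : j ≤ r) :
    1 ≤ Equiv.swap i (i + 1) j ∧ Equiv.swap i (i + 1) j ≤ r := by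
  rw [Equiv.swap_apply_def]; split_ifs <;> omega

theorem mul_mem_of_adjoin_right {s : Set A} {V : Submodule k A} (h : ∀ v ∈ V, ∀ y ∈ s, v * y ∈ V)
    {v x : A} (hv : v ∈ V) (hx : x ∈ Algebra.adjoin k s) : v * x ∈ V := by
  induction hx using Algebra.adjoin_induction generalizing v with
  | mem y hy => exact h v hv y hy
  | algebraMap c => rw [← Algebra.commutes, ← Algebra.smul_def]; exact V.smul_mem c hv
  | add a b _ _ ha hb => rw [mul_add]; exact V.add_mem (ha hv) (hb hv)
  | mul a b _ _ ha hb => rw [← mul_assoc]; exact hb (ha hv)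

theorem mul_mem_of_adjoin_left {s : Set A} {V : Submodule k A} (h : ∀ v ∈ V, ∀ y ∈ s, y * v ∈ V)
    {v x : A} (hv : v ∈ V) (hx : x ∈ Algebra.adjoin k s) : x * v ∈ V := by
  induction hx using Algebra.adjoin_induction generalizing v with
  | mem y hy => exact h v hv y hy
  | algebraMap c => rw [← Algebra.smul_def]; exact V.smul_mem c hv
  | add a b _ _ ha hb => rw [add_mul]; exact V.add_mem (ha hv) (hb hv)
  | mul a b _ _ ha hb => rw [mul_assoc]; exact ha (hb hv)

/-- To check that a linear map sends a span into a submodule it suffices to look at generators. -/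
theorem map_mem_of_span {B : Type*} [AddCommGroup B] [Module k B] {S : Set A} {V : Submodule k B}
    (φ : A →ₗ[k] B) (h : ∀ x ∈ S, φ x ∈ V) {x : A} (hx : x ∈ Submodule.span k S) : φ x ∈ V :=
  (Submodule.span_le.2 h : Submodule.span k S ≤ V.comap φ) hx

theorem exists_mul_comm_of_adjoin {s s' : Set A} {m : A}
    (h : ∀ y ∈ s, ∃ z ∈ Algebra.adjoin k s', m * y = z * m) {x : A}
    (hx : x ∈ Algebra.adjoin k s) : ∃ z ∈ Algebra.adjoin k s', m * x = z * m := by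
  induction hx using Algebra.adjoin_induction with
  | mem y hy => exact h y hy
  | algebraMap c => exact ⟨_, Subalgebra.algebraMap_mem _ c, (Algebra.commutes c m).symm⟩
  | add a b _ _ ha hb =>
    obtain ⟨a', h1, h2⟩ := ha
    obtain ⟨b', h3, h4⟩ := hb
    exact ⟨_, add_mem h1 h3, by rw [mul_add, add_mul, h2, h4]⟩
  | mul a b _ _ ha hb =>
    obtain ⟨a', h1, h2⟩ := ha
    obtain ⟨b', h3, h4⟩ := hb
    exact ⟨_, mul_mem h1 h3, by rw [← mul_assoc, h2, mul_assoc, h4, mul_assoc]⟩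

theorem op_mem_adjoin {s : Set A} {s' : Set Aᵐᵒᵖ} (h : ∀ y ∈ s, op y ∈ s') {x : A}
    (hx : x ∈ Algebra.adjoin k s) : op x ∈ Algebra.adjoin k s' := by
  induction hx using Algebra.adjoin_induction with
  | mem y hy => exact Algebra.subset_adjoin (h y hy)
  | algebraMap c => exact Subalgebra.algebraMap_mem _ c
  | add a b _ _ ha hb => exact add_mem ha hb
  | mul a b _ _ ha hb => exact mul_mem hb ha

namespace IsYokonumaHecke

variable {n : ℕ} {u : k} {t f : ℕ → A}

theorem f_t (h : IsYokonumaHecke n u t f) {i j : ℕ} (hi : 1 ≤ i) (hin : i < n) (hj : 1 ≤ j)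
    (hjn : j ≤ n) : f j * t i = t i * f (Equiv.swap i (i + 1) j) := by
  have := swap_mem_Icc hi hin hj hjn
  rw [h.t_f i _ hi hin this.1 this.2, Equiv.swap_apply_self]

/-- In the opposite algebra the quadratic relation has its framing coefficient on the wrong side of
`t i`; moving it across interchanges `f i` and `f (i + 1)`, so it stays in the same subalgebra. -/
theorem op (h : IsYokonumaHecke n u t f) :
    IsYokonumaHecke n u (fun i => op (t i)) (fun i => op (f i)) where
  toIsBraid := h.toIsBraid.op
  f_comm i j hi hin hj hjn := (h.f_comm i j hi hin hj hjn).op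
  t_f i j hi hin hj hjn := by rw [← op_mul, h.f_t hi hin hj hjn, op_mul]
  quad i hi hin := by
    obtain ⟨g, hg, e⟩ := h.quad i hi hin
    have key : ∃ g' ∈ Algebra.adjoin k {MulOpposite.op (f i), MulOpposite.op (f (i + 1))},
        MulOpposite.op (t i) * MulOpposite.op g = g' * MulOpposite.op (t i) := by
      refine exists_mul_comm_of_adjoin (s := {MulOpposite.op (f i), MulOpposite.op (f (i + 1))}) ?_
        (op_mem_adjoin ?_ hg)
      · rintro y (rfl | rfl)
        · refine ⟨_, Algebra.subset_adjoin (Or.inr rfl), ?_⟩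
          rw [← op_mul, h.f_t hi hin hi (by omega), Equiv.swap_apply_left, op_mul]
        · refine ⟨_, Algebra.subset_adjoin (Or.inl rfl), ?_⟩
          rw [← op_mul, h.f_t hi hin (by omega) (by omega), Equiv.swap_apply_right, op_mul]
      · rintro y (rfl | rfl) <;> simp
    obtain ⟨g', hg', e'⟩ := key
    exact ⟨g', hg', by rw [← e', ← op_mul, ← op_mul, e]; rfl⟩

theorem rev (h : IsYokonumaHecke n u t f) :
    IsYokonumaHecke n u (fun i => t (n - i)) (fun i => f (n + 1 - i)) where
  toIsBraid := h.toIsBraid.rev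
  f_comm i j hi hin hj hjn := h.f_comm _ _ (by omega) (by omega) (by omega) (by omega)
  t_f i j hi hin hj hjn := by
    rw [h.t_f _ _ (by omega) (by omega) (by omega) (by omega)]
    congr 2
    simp only [Equiv.swap_apply_def]
    split_ifs <;> omega
  quad i hi hin := by
    obtain ⟨g, hg, e⟩ := h.quad (n - i) (by omega) (by omega)
    refine ⟨g, ?_, e⟩
    rwa [show n - i + 1 = n + 1 - i by omega, Set.pair_comm,
      show n - i = n + 1 - (i + 1) by omega] at hg

theorem wordProd_mul_framing (h : IsYokonumaHecke n u t f) {r : ℕ} (hr : r ≤ n) {w : List ℕ}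
    (hw : ∀ i ∈ w, 1 ≤ i ∧ i < r) {y : A} (hy : y ∈ framing k f r) :
    ∃ z ∈ framing k f r, wordProd t w * y = z * wordProd t w := by
  induction w generalizing y with
  | nil => exact ⟨y, hy, by simp [wordProd]⟩
  | cons i w ih =>
    obtain ⟨z, hz, e⟩ := ih (fun j hj => hw j (by simp [hj])) hy
    obtain ⟨hi, hir⟩ := hw i (by simp)
    obtain ⟨z', hz', e'⟩ : ∃ z' ∈ framing k f r, t i * z = z' * t i := by
      refine exists_mul_comm_of_adjoin ?_ hz
      rintro _ ⟨j, ⟨hj, hjr⟩, rfl⟩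
      exact ⟨_, Algebra.subset_adjoin ⟨_, swap_mem_Icc hi hir hj hjr, rfl⟩,
        h.t_f i j hi (by omega) hj (by omega)⟩
    refine ⟨z', hz', ?_⟩
    have hc : wordProd t (i :: w) = t i * wordProd t w := by simp [wordProd]
    rw [hc, mul_assoc, e, ← mul_assoc, e', mul_assoc]

/-- The subalgebra generated by `t_1, …, t_{r-1}` and `f_1, …, f_r` is spanned by the products of
a framing element and a normal form. -/
theorem mem_span_of_mem_hecke (h : IsYokonumaHecke n u t f) {r : ℕ} (hr : r ≤ n) {x : A}
    (hx : x ∈ hecke k t f r) :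
    x ∈ Submodule.span k {x | ∃ y ∈ framing k f r, ∃ w ∈ normalForms r, x = y * wordProd t w} := by
  set S := {x | ∃ y ∈ framing k f r, ∃ w ∈ normalForms r, x = y * wordProd t w} with hS
  have h1 : (1 : A) ∈ Submodule.span k S :=
    Submodule.subset_span ⟨1, one_mem _, [], nil_mem_normalForms r, by simp [wordProd]⟩
  rw [← one_mul x]
  refine mul_mem_of_adjoin_right ?_ h1 hx
  intro v hv z hz
  refine map_mem_of_span (LinearMap.mulRight k z) ?_ hv
  rintro _ ⟨y, hy, w, hw, rfl⟩
  simp only [LinearMap.mulRight_apply]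
  have hw' := fun i hi => mem_of_mem_normalForms hw (i := i) hi
  rcases hz with ⟨i, ⟨hi, hir⟩, rfl⟩ | ⟨j, ⟨hj, hjr⟩, rfl⟩
  · obtain ⟨w', hw', ⟨-, e⟩ | ⟨-, e⟩⟩ := h.normalForms_mul hr hw hi hir
    · exact Submodule.subset_span ⟨y, hy, w', hw', by rw [mul_assoc, e]⟩
    · obtain ⟨g, hg, e'⟩ := h.quad i hi (by omega)
      have hg : g ∈ framing k f r := by
        refine Algebra.adjoin_mono ?_ hg
        rintro _ (rfl | rfl)
        · exact ⟨i, ⟨hi, by omega⟩, rfl⟩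
        · exact ⟨i + 1, ⟨by omega, by omega⟩, rfl⟩
      obtain ⟨z, hz, e''⟩ := h.wordProd_mul_framing hr
        (fun i hi => mem_of_mem_normalForms hw' (i := i) hi) hg
      -- The quadratic relation is applied to the square at the end of `w' t_i t_i`. In its second
      -- term the surviving `t i` restores `w`, since `wordProd t w = wordProd t w' * t i`.
      have : y * wordProd t w * t i = u • (y * wordProd t w') + y * z * wordProd t w := by
        rw [e, mul_assoc, mul_assoc (wordProd t w'), e', mul_add, ← Algebra.commutes,
          ← Algebra.smul_def, ← mul_assoc (wordProd t w'), e'']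
        simp only [mul_add, mul_smul_comm, mul_assoc]
      rw [this]
      exact add_mem (Submodule.smul_mem _ _ (Submodule.subset_span ⟨y, hy, w', hw', rfl⟩))
        (Submodule.subset_span ⟨_, mul_mem hy hz, w, hw, rfl⟩)
  · obtain ⟨z, hz, e⟩ := h.wordProd_mul_framing hr hw'
      (Algebra.subset_adjoin ⟨j, ⟨hj, hjr⟩, rfl⟩)
    exact Submodule.subset_span ⟨_, mul_mem hy hz, w, hw, by rw [mul_assoc, e, mul_assoc]⟩

theorem f_mul_seg (h : IsYokonumaHecke n u t f) {l j i : ℕ} (hj : 1 ≤ j) (hl : l ≤ n)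
    (hi : 1 ≤ i) (hin : i ≤ n) : ∃ i', 1 ≤ i' ∧ i' ≤ n ∧ f i * seg t l j = seg t l j * f i' := by
  rcases le_or_gt l j with hlj | hlj
  · exact ⟨i, hi, hin, by simp [seg, Nat.sub_eq_zero_of_le hlj]⟩
  induction l, hlj using Nat.le_induction generalizing i with
  | base =>
    have := swap_mem_Icc hj (by omega : j < n) hi hin
    exact ⟨_, this.1, this.2, by simpa [seg_succ t le_rfl] using h.f_t hj (by omega) hi hin⟩
  | succ l hlj ih =>
    have := swap_mem_Icc (by omega : 1 ≤ l) (by omega : l < n) hi hin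
    obtain ⟨i', h1, h2, h3⟩ := ih (by omega) this.1 this.2
    refine ⟨i', h1, h2, ?_⟩
    rw [seg_succ t (by omega), ← mul_assoc, h.f_t (by omega) (by omega) hi hin, mul_assoc, h3,
      mul_assoc]

theorem f_mul_lowProd (h : IsYokonumaHecke n u t f) {l i : ℕ} {as : List ℕ} (has : IncrIn l n as)
    (hi : 1 ≤ i) (hin : i ≤ n) :
    ∃ i', 1 ≤ i' ∧ i' ≤ n ∧ f i * lowProd t l as = lowProd t l as * f i' := by
  induction as generalizing l i with
  | nil => exact ⟨i, hi, hin, by simp [lowProd]⟩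
  | cons a as ih =>
    obtain ⟨h1, h2, h3⟩ := IncrIn.cons_iff.1 has
    obtain ⟨i', h4, h5, h6⟩ := h.f_mul_seg (l := a) (j := l + 1) (by omega) h2 hi hin
    obtain ⟨i'', h7, h8, h9⟩ := ih (l := l + 1) (h3.mono h1) h4 h5
    exact ⟨i'', h7, h8, by rw [lowProd, ← mul_assoc, h6, mul_assoc, h9, mul_assoc]⟩

theorem lowProd_range' (t : ℕ → A) (l r : ℕ) : lowProd t l (List.range' (l + 1) r) = 1 := by
  induction r generalizing l with
  | zero => rfl
  | succ r ih => rw [List.range'_succ, lowProd, ih, seg_self, one_mul]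

/-- If `X` is stable under all generators but `t_r`, then the module generated by `X` is the sum of
the `t_{a_1,1} ⋯ t_{a_r,r} X`. -/
theorem mul_mem_span_lowProd (h : IsYokonumaHecke n u t f) {r : ℕ} (hr : r ≤ n)
    {X : Submodule k A} (hXt : ∀ j, 1 ≤ j → j < n → j ≠ r → ∀ x ∈ X, t j * x ∈ X)
    (hXf : ∀ j, 1 ≤ j → j ≤ n → ∀ x ∈ X, f j * x ∈ X) {y x : A} (hy : y ∈ hecke k t f n)
    (hx : x ∈ X) :
    y * x ∈ Submodule.span k
      {z | ∃ as, IncrIn 0 n as ∧ as.length = r ∧ ∃ x ∈ X, z = lowProd t 0 as * x} := by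
  set S := {z | ∃ as, IncrIn 0 n as ∧ as.length = r ∧ ∃ x ∈ X, z = lowProd t 0 as * x} with hS
  have hfS : ∀ v ∈ Submodule.span k S, ∀ z ∈ f '' Set.Icc 1 n, z * v ∈ Submodule.span k S := by
    rintro v hv _ ⟨j, ⟨hj, hjn⟩, rfl⟩
    refine map_mem_of_span (LinearMap.mulLeft k (f j)) ?_ hv
    rintro _ ⟨as, has, hl, x, hx, rfl⟩
    obtain ⟨j', h1, h2, h3⟩ := h.f_mul_lowProd has hj hjn
    rw [LinearMap.mulLeft_apply, ← mul_assoc, h3, mul_assoc]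
    exact Submodule.subset_span ⟨as, has, hl, _, hXf j' h1 h2 x hx, rfl⟩
  -- The list `1, …, r` has trivial low product, which puts `x` itself into the span.
  refine mul_mem_of_adjoin_left ?_ (Submodule.subset_span ⟨List.range' 1 r, ?_, by simp, x, hx, ?_⟩)
    hy
  · rintro v hv z (⟨i, ⟨hi, hin⟩, rfl⟩ | hz)
    · refine map_mem_of_span (LinearMap.mulLeft k (t i)) ?_ hv
      rintro _ ⟨as, has, hl, x, hx, rfl⟩
      rw [LinearMap.mulLeft_apply, ← mul_assoc]
      rcases h.mul_lowProd le_rfl hi hin has with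
        ⟨j, h1, h2, h3, h4⟩ | ⟨as', h1, h2, h3⟩ | ⟨as', h1, h2, h3⟩
      · rw [h4, mul_assoc]
        exact Submodule.subset_span ⟨as, has, hl, _, hXt j h1 h2 (by omega) x hx, rfl⟩
      · rw [h3]
        exact Submodule.subset_span ⟨as', h1, by omega, _, hx, rfl⟩
      · obtain ⟨g, hg, e⟩ := h.quad i hi hin
        have hg : g ∈ framing k f n := by
          refine Algebra.adjoin_mono ?_ hg
          rintro _ (rfl | rfl)
          · exact ⟨i, ⟨hi, by omega⟩, rfl⟩
          · exact ⟨i + 1, ⟨by omega, by omega⟩, rfl⟩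
        -- Here `t_A = t_i t_{A'}`, so the quadratic relation gives `t_i t_A = u t_{A'} + g t_A`.
        have e' : t i * lowProd t 0 as * x
            = u • (lowProd t 0 as' * x) + g * (lowProd t 0 as * x) := by
          rw [h3, ← mul_assoc, e, add_mul, ← Algebra.smul_def, add_mul, smul_mul_assoc]
          simp only [mul_assoc]
        rw [e']
        exact add_mem (Submodule.smul_mem _ _ (Submodule.subset_span ⟨as', h1, by omega, x, hx, rfl⟩))
          (mul_mem_of_adjoin_left hfS (Submodule.subset_span ⟨as, has, hl, x, hx, rfl⟩) hg)
    · exact hfS v hv z hz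
  · refine ⟨List.pairwise_lt_range', fun a ha => ?_⟩
    rw [List.mem_range'_1] at ha; omega
  · have := lowProd_range' t 0 r
    rw [zero_add] at this
    rw [this, one_mul]

end IsYokonumaHecke
end YokonumaHecke
-- Straightening with powers of N
open MulOpposite

section Rook

variable {k A : Type*} [Field k] [Ring A] [Algebra k A]

/-- Elements that satisfy the relations of the Rook Yokonuma--Hecke algebra. -/
structure IsRook (n : ℕ) (u : k) (t f : ℕ → A) (N : A) : Prop
    extends IsYokonumaHecke n u t f where
  f_N : ∀ i, 1 ≤ i → i < n → f i * N = N * f (i + 1)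
  N_f_one : N * f 1 = N
  f_last_N : f n * N = N
  N_pow_t : ∀ i, 1 ≤ i → i < n → N ^ (i + 1) * t i = u • N ^ (i + 1)
  t_N_pow : ∀ i, 1 ≤ i → i < n → t i * N ^ (n - i + 1) = u • N ^ (n - i + 1)
  t_N : ∀ i, 1 ≤ i → i + 1 < n → t i * N = N * t (i + 1)
  N_t_N : N * wordProd t (List.range' 1 (n - 1)) * N = u ^ (n - 1) • N

namespace IsRook

variable {n : ℕ} {u : k} {t f : ℕ → A} {N : A}

theorem pow_f_shift (h : IsRook n u t f N) {i m : ℕ} (hi : 1 ≤ i) (him : i + m ≤ n) :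
    f i * N ^ m = N ^ m * f (i + m) := by
  induction m with
  | zero => simp
  | succ m ih =>
    rw [pow_succ, ← mul_assoc, ih (by omega), mul_assoc, h.f_N _ (by omega) (by omega),
      ← mul_assoc]
    rfl

theorem pow_t_shift (h : IsRook n u t f N) {i m : ℕ} (hi : 1 ≤ i) (him : i + m < n) :
    t i * N ^ m = N ^ m * t (i + m) := by
  induction m with
  | zero => simp
  | succ m ih =>
    rw [pow_succ, ← mul_assoc, ih (by omega), mul_assoc, h.t_N _ (by omega) (by omega),
      ← mul_assoc]
    rfl

/-- After `n - i` shifts `f i` has become `f n`, and the next factor `N` absorbs it. -/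
theorem f_mul_pow (h : IsRook n u t f N) {i m : ℕ} (hi : 1 ≤ i) (hin : i ≤ n) (hm : n < i + m) :
    f i * N ^ m = N ^ m := by
  obtain ⟨l, rfl⟩ : ∃ l, m = (n - i) + 1 + l := ⟨m - (n - i) - 1, by omega⟩
  rw [pow_add, ← mul_assoc, pow_succ, ← mul_assoc, h.pow_f_shift hi (by omega),
    show i + (n - i) = n by omega, mul_assoc _ (f n), h.f_last_N]

theorem t_mul_pow (h : IsRook n u t f N) {i m : ℕ} (hi : 1 ≤ i) (hin : i < n) (hm : n < i + m) :
    t i * N ^ m = u • N ^ m := by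
  obtain ⟨l, rfl⟩ : ∃ l, m = (n - i + 1) + l := ⟨m - (n - i) - 1, by omega⟩
  rw [pow_add, ← mul_assoc, h.t_N_pow i hi hin, smul_mul_assoc]

theorem wordProd_op_reverse (t : ℕ → A) (w : List ℕ) :
    unop (wordProd (fun i => op (t i)) w) = wordProd t w.reverse := by
  induction w with
  | nil => rfl
  | cons a w ih => simp [wordProd] at ih ⊢; rw [ih]

theorem wordProd_map (t : ℕ → A) (g : ℕ → ℕ) (w : List ℕ) :
    wordProd t (w.map g) = wordProd (fun i => t (g i)) w := by
  simp [wordProd, Function.comp_def]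

/-- The relations are invariant under reversing both products and indices, so every statement about
left multiplication has a mirror image on the right. The word `t_1 ⋯ t_{n-1}` is reversed twice and
hence unchanged. -/
theorem op_rev (h : IsRook n u t f N) :
    IsRook n u (fun i => op (t (n - i))) (fun i => op (f (n + 1 - i))) (op N) where
  toIsYokonumaHecke := h.toIsYokonumaHecke.rev.op
  f_N i hi hin := by
    have := h.f_N (n - i) (by omega) (by omega)
    rw [show n - i + 1 = n + 1 - i by omega] at this
    rw [← op_mul, ← this, op_mul, show n + 1 - (i + 1) = n - i by omega]
  N_f_one := by
    rw [← op_mul, show n + 1 - 1 = n by omega, h.f_last_N]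
  f_last_N := by
    rw [← op_mul, show n + 1 - n = 1 by omega, h.N_f_one]
  N_pow_t i hi hin := by
    have := h.t_N_pow (n - i) (by omega) (by omega)
    rw [show n - (n - i) + 1 = i + 1 by omega] at this
    rw [← op_pow, ← op_mul, this]; rfl
  t_N_pow i hi hin := by
    have := h.N_pow_t (n - i) (by omega) (by omega)
    rw [← op_pow, ← op_mul, this]; rfl
  t_N i hi hin := by
    have := h.t_N (n - (i + 1)) (by omega) (by omega)
    rw [show n - (i + 1) + 1 = n - i by omega] at this
    rw [← op_mul, ← this, op_mul]
  N_t_N := by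
    have e : wordProd (fun i => op (t (n - i))) (List.range' 1 (n - 1))
        = op (wordProd t (List.range' 1 (n - 1))) := by
      rw [← unop_inj, wordProd_op_reverse (fun i => t (n - i)), ← wordProd_map, unop_op,
        List.map_reverse]
      congr 1
      apply List.ext_getElem
      · simp
      · intro i h1 h2
        simp at h1 h2
        simp; omega
    rw [e, ← op_mul, ← op_mul, ← mul_assoc, h.N_t_N]; rfl

/-- The products `t_{a_1,1} ⋯ t_{a_r,r} y N^m` with `m = n - r` and `y` in the subalgebra
belonging to the first `r` indices span the left module generated by `N^m`. -/
theorem mul_pow_mem_span (h : IsRook n u t f N) {m : ℕ} (hm : m ≤ n) {x : A}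
    (hx : x ∈ hecke k t f n) :
    x * N ^ m ∈ Submodule.span k {z | ∃ as, IncrIn 0 n as ∧ as.length = n - m ∧
      ∃ y ∈ hecke k t f (n - m), z = lowProd t 0 as * (y * N ^ m)} := by
  set X : Submodule k A :=
    (hecke k t f (n - m)).toSubmodule.map (LinearMap.mulRight k (N ^ m)) with hX
  -- Generators with index above `n - m` commute with the subalgebra of the first `n - m` indices
  -- and act on `N ^ m` by a scalar.
  have key : ∀ (a b : A), a ∈ hecke k t f (n - m) → (∃ c : k, b * N ^ m = c • N ^ m) →
      (∀ z ∈ t '' Set.Ico 1 (n - m) ∪ f '' Set.Icc 1 (n - m), Commute b z) →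
      b * (a * N ^ m) ∈ X := by
    rintro a b ha ⟨c, hc⟩ hcomm
    have : Commute b a := Algebra.commute_of_mem_adjoin_of_forall_mem_commute ha hcomm
    refine ⟨c • a, Subalgebra.smul_mem _ ha c, ?_⟩
    rw [LinearMap.mulRight_apply, ← mul_assoc, this.eq, mul_assoc, hc, mul_smul_comm,
      smul_mul_assoc]
  have gen : ∀ (a b : A), a ∈ hecke k t f (n - m) →
      b ∈ t '' Set.Ico 1 (n - m) ∪ f '' Set.Icc 1 (n - m) → b * (a * N ^ m) ∈ X :=
    fun a b ha hb => ⟨b * a, Subalgebra.mul_mem _ (Algebra.subset_adjoin hb) ha, by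
      rw [LinearMap.mulRight_apply, mul_assoc]⟩
  have comm_t_f : ∀ i j, 1 ≤ i → i < n → 1 ≤ j → j ≤ n → j ≠ i → j ≠ i + 1 →
      Commute (t i) (f j) := by
    intro i j hi hin hj hjn h1 h2
    have := h.t_f i j hi hin hj hjn
    rwa [Equiv.swap_apply_of_ne_of_ne h1 h2] at this
  have := h.mul_mem_span_lowProd (r := n - m) (by omega) (X := X) ?_ ?_ hx
    ⟨1, Subalgebra.one_mem _, by rw [LinearMap.mulRight_apply, one_mul]⟩
  · refine Submodule.span_mono ?_ this
    rintro _ ⟨as, h1, h2, _, ⟨y, hy, rfl⟩, rfl⟩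
    exact ⟨as, h1, h2, y, hy, rfl⟩
  · rintro j hj hjn hjr _ ⟨y, hy, rfl⟩
    rcases lt_or_gt_of_ne hjr with hlt | hgt
    · exact gen _ _ hy (Or.inl ⟨j, ⟨hj, hlt⟩, rfl⟩)
    · refine key _ _ hy ⟨u, h.t_mul_pow hj hjn (by omega)⟩ ?_
      rintro _ (⟨i, ⟨hi, hir⟩, rfl⟩ | ⟨i, ⟨hi, hir⟩, rfl⟩)
      · exact h.commute hj hi hjn (by omega) (Or.inr (by omega))
      · exact comm_t_f _ _ hj hjn hi (by omega) (by omega) (by omega)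
  · rintro j hj hjn _ ⟨y, hy, rfl⟩
    rcases le_or_gt j (n - m) with hlt | hgt
    · exact gen _ _ hy (Or.inr ⟨j, ⟨hj, hlt⟩, rfl⟩)
    · refine key _ _ hy ⟨1, by rw [one_smul, h.f_mul_pow hj hjn (by omega)]⟩ ?_
      rintro _ (⟨i, ⟨hi, hir⟩, rfl⟩ | ⟨i, ⟨hi, hir⟩, rfl⟩)
      · exact (comm_t_f _ _ hi (by omega) hj hjn (by omega) (by omega)).symm
      · exact h.f_comm _ _ hj hjn hi (by omega)

theorem op_mem_hecke_rev {x : A} (hx : x ∈ hecke k t f n) :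
    op x ∈ hecke k (fun i => op (t (n - i))) (fun i => op (f (n + 1 - i))) n := by
  refine op_mem_adjoin ?_ hx
  rintro _ (⟨i, ⟨hi, hin⟩, rfl⟩ | ⟨i, ⟨hi, hin⟩, rfl⟩)
  · exact Or.inl ⟨n - i, ⟨by omega, by omega⟩, by simp only [show n - (n - i) = i by omega]⟩
  · exact Or.inr ⟨n + 1 - i, ⟨by omega, by omega⟩, by
      simp only [show n + 1 - (n + 1 - i) = i by omega]⟩

/-- After the reversal, the subalgebra of the first `n - m` indices is the one of the last `n - m`
indices, and moving `N ^ m` to the right of it lowers all indices by `m`. Thus the coefficients from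
the left and the right straightening lie in one and the same subalgebra. -/
theorem pow_mul_unop (h : IsRook n u t f N) {m : ℕ} (hm : m ≤ n) {y : Aᵐᵒᵖ}
    (hy : y ∈ hecke k (fun i => op (t (n - i))) (fun i => op (f (n + 1 - i))) (n - m)) :
    ∃ z ∈ hecke k t f (n - m), N ^ m * unop y = z * N ^ m := by
  induction hy using Algebra.adjoin_induction with
  | mem y hy =>
    rcases hy with ⟨i, ⟨hi, hin⟩, rfl⟩ | ⟨i, ⟨hi, hin⟩, rfl⟩
    · refine ⟨t (n - i - m), Algebra.subset_adjoin (Or.inl ⟨_, ⟨by omega, by omega⟩, rfl⟩), ?_⟩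
      rw [h.pow_t_shift (by omega) (by omega), show n - i - m + m = n - i by omega, unop_op]
    · refine ⟨f (n + 1 - i - m), Algebra.subset_adjoin (Or.inr ⟨_, ⟨by omega, by omega⟩, rfl⟩), ?_⟩
      rw [h.pow_f_shift (by omega) (by omega), show n + 1 - i - m + m = n + 1 - i by omega,
        unop_op]
  | algebraMap c =>
    exact ⟨_, Subalgebra.algebraMap_mem _ c, (Algebra.commutes c (N ^ m)).symm⟩
  | add a b _ _ ha hb =>
    obtain ⟨a', h1, h2⟩ := ha
    obtain ⟨b', h3, h4⟩ := hb
    exact ⟨_, add_mem h1 h3, by rw [unop_add, mul_add, add_mul, h2, h4]⟩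
  | mul a b _ _ ha hb =>
    obtain ⟨a', h1, h2⟩ := ha
    obtain ⟨b', h3, h4⟩ := hb
    exact ⟨_, mul_mem h3 h1, by rw [unop_mul, ← mul_assoc, h4, mul_assoc, h2, mul_assoc]⟩

/-- The standard elements with a fixed power of `N`. -/
def standardSet (k : Type*) {A : Type*} [Field k] [Ring A] [Algebra k A] (n : ℕ) (t f : ℕ → A)
    (N : A) (m : ℕ) : Set A :=
  {z | ∃ as bs, IncrIn 0 n as ∧ as.length = n - m ∧ IncrIn 0 n bs ∧ bs.length = n - m ∧
    ∃ y ∈ framing k f (n - m), ∃ w ∈ normalForms (n - m), z = lowProd t 0 as * y *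
      wordProd t w * N ^ m * unop (lowProd (fun i => op (t (n - i))) 0 bs)}

theorem mul_pow_mul_mem_span (h : IsRook n u t f N) {m : ℕ} (hm : m ≤ n) {x x' : A}
    (hx : x ∈ hecke k t f n) (hx' : x' ∈ hecke k t f n) :
    x * N ^ m * x' ∈ Submodule.span k (standardSet k n t f N m) := by
  refine map_mem_of_span (LinearMap.mulRight k x') ?_ (h.mul_pow_mem_span hm hx)
  rintro _ ⟨as, has, hl, y, hy, rfl⟩
  -- The right factor is straightened by the left-hand result in the reversed opposite algebra.
  have h2 := h.op_rev.mul_pow_mem_span hm (op_mem_hecke_rev hx')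
  rw [← op_pow, ← op_mul] at h2
  refine map_mem_of_span (V := Submodule.span k (standardSet k n t f N m))
    ((LinearMap.mulLeft k (lowProd t 0 as * y)).comp
    (MulOpposite.opLinearEquiv k).symm.toLinearMap) ?_ h2 |> fun h3 => ?_
  · convert h3 using 1
    simp [mul_assoc]
  · rintro _ ⟨bs, hbs, hbl, y', hy', rfl⟩
    obtain ⟨z, hz, e⟩ := h.pow_mul_unop hm hy'
    refine map_mem_of_span (V := Submodule.span k (standardSet k n t f N m))
      ((LinearMap.mulLeft k (lowProd t 0 as)).comp (LinearMap.mulRight k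
      (N ^ m * unop (lowProd (fun i => op (t (n - i))) 0 bs)))) ?_
      (h.mem_span_of_mem_hecke (by omega) (mul_mem hy hz)) |> fun h3 => ?_
    · convert h3 using 1
      simp only [LinearMap.comp_apply, LinearMap.mulLeft_apply, LinearEquiv.coe_coe,
        coe_opLinearEquiv_symm, LinearMap.mulRight_apply, unop_mul, unop_op]
      rw [e]
      simp only [mul_assoc]
    · rintro _ ⟨v, hv, w, hw, rfl⟩
      refine Submodule.subset_span ⟨as, bs, has, hl, hbs, hbl, v, hv, w, hw, ?_⟩
      simp [mul_assoc]

/-! ### Closure under left multiplication by N -/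

theorem hecke_ascending {a b : ℕ} (ha : 1 ≤ a) (hab : a + b ≤ n) :
    wordProd t (List.range' a b) ∈ hecke k t f n := by
  refine list_prod_mem fun x hx => ?_
  obtain ⟨i, hi, rfl⟩ := List.mem_map.1 hx
  rw [List.mem_range'_1] at hi
  exact Algebra.subset_adjoin (Or.inl ⟨i, ⟨by omega, by omega⟩, rfl⟩)

theorem ascending_succ (t : ℕ → A) (b : ℕ) :
    wordProd t (List.range' 1 (b + 1)) = wordProd t (List.range' 1 b) * t (b + 1) := by
  rw [List.range'_1_concat, wordProd_append, add_comm]; simp [wordProd]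

/-- Multiply the identity for `m` by `N` on the right. The last letter `t (n - m)` is then absorbed
by `N ^ (m + 1)` with a factor `u`, which is cancelled; this is where `u ≠ 0` matters. -/
theorem N_mul_ascending_mul_pow (h : IsRook n u t f N) (hu : u ≠ 0) {m : ℕ} (hm : 1 ≤ m)
    (hmn : m ≤ n) :
    N * wordProd t (List.range' 1 (n - m)) * N ^ m = u ^ (n - m) • N ^ m := by
  induction m, hm using Nat.le_induction with
  | base => simpa using h.N_t_N
  | succ m hm ih =>
    have e := congrArg (· * N) (ih (by omega))
    simp only [smul_mul_assoc, mul_assoc, ← pow_succ] at e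
    obtain ⟨l, hl⟩ : ∃ l, n - m = l + 1 := ⟨n - m - 1, by omega⟩
    rw [show n - (m + 1) = l by omega]
    rw [hl, ascending_succ, mul_assoc _ (t (l + 1)), h.t_mul_pow (by omega) (by omega) (by omega),
      mul_smul_comm, mul_smul_comm, pow_succ' u, mul_smul] at e
    rw [mul_assoc]
    exact smul_right_injective A hu e

theorem ascending_mul_pow (h : IsRook n u t f N) {m b : ℕ} (hb : b + m < n) :
    wordProd t (List.range' 1 b) * N ^ m = N ^ m * wordProd t (List.range' (1 + m) b) := by
  induction b with
  | zero => simp [wordProd]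
  | succ b ih =>
    rw [ascending_succ, mul_assoc, h.pow_t_shift (by omega) (by omega), ← mul_assoc,
      ih (by omega), List.range'_1_concat, wordProd_append, mul_assoc]
    simp [wordProd, show 1 + m + b = b + 1 + m by omega]

/-- All products `x N^m x'` with `m ≤ n` and `x`, `x'` in the subalgebra of the `t_i` and `f_j`. -/
def sandwich (k : Type*) {A : Type*} [Field k] [Ring A] [Algebra k A] (n : ℕ) (t f : ℕ → A)
    (N : A) : Set A :=
  {z | ∃ m ≤ n, ∃ x ∈ hecke k t f n, ∃ x' ∈ hecke k t f n, z = x * N ^ m * x'}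

theorem mul_mem_sandwich {x z : A} (hx : x ∈ hecke k t f n)
    (hz : z ∈ Submodule.span k (sandwich k n t f N)) :
    x * z ∈ Submodule.span k (sandwich k n t f N) := by
  refine map_mem_of_span (LinearMap.mulLeft k x) ?_ hz
  rintro _ ⟨m, hm, y, hy, y', hy', rfl⟩
  exact Submodule.subset_span ⟨m, hm, x * y, mul_mem hx hy, y', hy', by simp [mul_assoc]⟩

theorem N_mul_ascending_mem (h : IsRook n u t f N) (hu : u ≠ 0) {m b : ℕ} (hm : m ≤ n)
    (hb : b < n) {x : A} (hx : x ∈ hecke k t f n) :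
    N * wordProd t (List.range' 1 b) * N ^ m * x ∈ Submodule.span k (sandwich k n t f N) := by
  rcases Nat.eq_zero_or_pos m with rfl | hm0
  · refine Submodule.subset_span ⟨1, by omega, 1, one_mem _, _,
      mul_mem (hecke_ascending (b := b) le_rfl (by omega)) hx, by simp [mul_assoc]⟩
  induction b with
  | zero =>
    rcases Nat.lt_or_ge m n with hmn | hmn
    · exact Submodule.subset_span ⟨m + 1, by omega, 1, one_mem _, x, hx, by
        simp [wordProd, pow_succ']⟩
    -- For `m = n` the preceding identity says `N * N ^ n = N ^ n`, so exponents above `n` are never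
    -- needed.
    · obtain rfl : m = n := by omega
      have := h.N_mul_ascending_mul_pow hu hm0 le_rfl
      rw [Nat.sub_self] at this
      rw [this]
      exact Submodule.subset_span ⟨m, le_rfl, 1, one_mem _, x, hx, by simp⟩
  | succ b ih =>
    -- A short ascending word passes through `N ^ m`; one of length `n - m` is swallowed by the
    -- identity above; a longer one loses its last letter to `N ^ m`.
    rcases lt_trichotomy (b + 1) (n - m) with hlt | heq | hgt
    · rw [mul_assoc N, h.ascending_mul_pow (by omega), ← mul_assoc, ← pow_succ', mul_assoc]
      exact Submodule.subset_span ⟨m + 1, by omega, 1, one_mem _, _,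
        mul_mem (hecke_ascending (a := 1 + m) (b := b + 1) (by omega) (by omega)) hx, by
          rw [one_mul]⟩
    · rw [heq, h.N_mul_ascending_mul_pow hu hm0 hm, smul_mul_assoc]
      exact Submodule.smul_mem _ _ (Submodule.subset_span ⟨m, hm, 1, one_mem _, x, hx, by simp⟩)
    · rw [ascending_succ, ← mul_assoc, mul_assoc _ (t (b + 1)),
        h.t_mul_pow (by omega) hb (by omega), mul_smul_comm, smul_mul_assoc]
      exact Submodule.smul_mem _ _ (ih (by omega))

theorem unop_seg (t : ℕ → A) (b : ℕ) :
    unop (seg (fun i => op (t i)) (b + 1) 1) = wordProd t (List.range' 1 b) := by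
  induction b with
  | zero => simp [wordProd]
  | succ b ih => rw [seg_succ _ (by omega), unop_mul, ih, ascending_succ, unop_op]

theorem N_mul_mem_sandwich (h : IsRook n u t f N) (hu : u ≠ 0) (hn : 1 ≤ n) {z : A}
    (hz : z ∈ Submodule.span k (sandwich k n t f N)) :
    N * z ∈ Submodule.span k (sandwich k n t f N) := by
  refine map_mem_of_span (LinearMap.mulLeft k N) ?_ hz
  rintro _ ⟨m, hm, x, hx, x', hx', rfl⟩
  -- These generators omit `t 1`, and each of them can be moved from the right of `N` to its left,
  -- `f 1` disappearing. The coset statement with `r = 1` in the opposite algebra leaves only the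
  -- words `t_1 ⋯ t_b` next to `N ^ m`.
  set S : Set Aᵐᵒᵖ := (fun i => op (t i)) '' Set.Ioo 1 n ∪ (fun i => op (f i)) '' Set.Icc 1 n
  have hop : op x ∈ hecke k (fun i => op (t i)) (fun i => op (f i)) n := by
    refine op_mem_adjoin ?_ hx
    rintro _ (⟨i, hi, rfl⟩ | ⟨i, hi, rfl⟩)
    · exact Or.inl ⟨i, hi, rfl⟩
    · exact Or.inr ⟨i, hi, rfl⟩
  have h1 := h.toIsYokonumaHecke.op.mul_mem_span_lowProd (r := 1) hn
    (X := (Algebra.adjoin k S).toSubmodule)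
    (fun j hj hjn hj1 x hx => Subalgebra.mul_mem _ (Algebra.subset_adjoin
      (Or.inl ⟨j, ⟨by omega, hjn⟩, rfl⟩)) hx)
    (fun j hj hjn x hx => Subalgebra.mul_mem _ (Algebra.subset_adjoin (Or.inr ⟨j, ⟨hj, hjn⟩, rfl⟩)) hx)
    hop (Subalgebra.one_mem _)
  rw [mul_one] at h1
  refine map_mem_of_span (V := Submodule.span k (sandwich k n t f N))
    (((LinearMap.mulLeft k N).comp (LinearMap.mulRight k (N ^ m * x'))).comp
    (MulOpposite.opLinearEquiv k).symm.toLinearMap) ?_ h1 |> fun h3 => ?_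
  · convert h3 using 1
    simp [mul_assoc]
  · rintro _ ⟨as, has, hl, y, hy, rfl⟩
    obtain ⟨a, rfl⟩ := List.length_eq_one_iff.1 hl
    obtain ⟨ha, han, -⟩ := IncrIn.cons_iff.1 has
    obtain ⟨b, rfl⟩ : ∃ b, a = b + 1 := ⟨a - 1, by omega⟩
    have hy' : ∃ v ∈ hecke k t f n, N * unop y = v * N := by
      rw [Subalgebra.mem_toSubmodule] at hy
      induction hy using Algebra.adjoin_induction with
      | mem y hy =>
        rcases hy with ⟨i, ⟨hi, hin⟩, rfl⟩ | ⟨i, ⟨hi, hin⟩, rfl⟩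
        · refine ⟨t (i - 1), Algebra.subset_adjoin (Or.inl ⟨_, ⟨by omega, by omega⟩, rfl⟩), ?_⟩
          rw [h.t_N _ (by omega) (by omega), show i - 1 + 1 = i by omega, unop_op]
        · rcases hi.eq_or_lt with rfl | hi
          · exact ⟨1, one_mem _, by rw [unop_op, h.N_f_one, one_mul]⟩
          · refine ⟨f (i - 1), Algebra.subset_adjoin (Or.inr ⟨_, ⟨by omega, by omega⟩, rfl⟩), ?_⟩
            rw [h.f_N _ (by omega) (by omega), show i - 1 + 1 = i by omega, unop_op]
      | algebraMap c => exact ⟨_, Subalgebra.algebraMap_mem _ c, (Algebra.commutes c N).symm⟩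
      | add a b _ _ ha hb =>
        obtain ⟨a', h1, h2⟩ := ha
        obtain ⟨b', h3, h4⟩ := hb
        exact ⟨_, add_mem h1 h3, by rw [unop_add, mul_add, add_mul, h2, h4]⟩
      | mul a b _ _ ha hb =>
        obtain ⟨a', h1, h2⟩ := ha
        obtain ⟨b', h3, h4⟩ := hb
        exact ⟨_, mul_mem h3 h1, by rw [unop_mul, ← mul_assoc, h4, mul_assoc, h2, mul_assoc]⟩
    obtain ⟨v, hv, e⟩ := hy'
    have e2 : N * (unop (lowProd (fun i => op (t i)) 0 [b + 1] * y) * (N ^ m * x'))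
        = v * (N * wordProd t (List.range' 1 b) * N ^ m * x') := by
      rw [unop_mul, mul_assoc, ← mul_assoc N, e]
      simp only [lowProd, mul_one, zero_add, unop_seg, mul_assoc]
    have e3 := mul_mem_sandwich hv (h.N_mul_ascending_mem hu hm (b := b) (by omega) hx')
    rw [← e2] at e3
    exact e3

theorem one_mem_sandwich : (1 : A) ∈ Submodule.span k (sandwich k n t f N) :=
  Submodule.subset_span ⟨0, by omega, 1, one_mem _, 1, one_mem _, by simp⟩

/-- If the elements generate the algebra, then it is spanned by the standard elements. -/
theorem span_standardSet (h : IsRook n u t f N) (hu : u ≠ 0) (hn : 1 ≤ n)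
    (hgen : Algebra.adjoin k (t '' Set.Ico 1 n ∪ f '' Set.Icc 1 n ∪ {N}) = ⊤) :
    Submodule.span k (⋃ m ∈ Set.Iic n, standardSet k n t f N m) = ⊤ := by
  refine eq_top_iff.2 fun x _ => ?_
  have hx : x ∈ Submodule.span k (sandwich k n t f N) := by
    rw [← mul_one x]
    refine mul_mem_of_adjoin_left ?_ one_mem_sandwich (hgen ▸ Algebra.mem_top : x ∈
      Algebra.adjoin k (t '' Set.Ico 1 n ∪ f '' Set.Icc 1 n ∪ {N}))
    rintro v hv y (hy | rfl)
    · exact mul_mem_sandwich (Algebra.subset_adjoin hy) hv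
    · exact h.N_mul_mem_sandwich hu hn hv
  refine (Submodule.span_le.2 ?_) hx
  rintro _ ⟨m, hm, x, hx, x', hx', rfl⟩
  exact Submodule.span_mono (Set.subset_biUnion_of_mem (show m ∈ Set.Iic n from hm))
    (h.mul_pow_mul_mem_span hm hx hx')

end IsRook
end Rook
end RookYH

/-! ### The standard elements span the algebra -/

noncomputable section
namespace RookYH
open MulOpposite

section Span

variable (K : Type*) [Field K] (n d : ℕ)

theorem F_pow_d {i : ℕ} (hi : 1 ≤ i) (hin : i ≤ n) : F K n d i ^ d = 1 := by
  simpa [F] using RingQuot.mkAlgHom_rel (RatFunc K) (Rel.F_pow (K := K) (n := n) (d := d) i ⟨hi, hin⟩)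

theorem isRook : IsRook n (RatFunc.X : RatFunc K) (T K n d) (F K n d) (N K n d) where
  braid i hi hin := by
    simpa [T] using RingQuot.mkAlgHom_rel (RatFunc K) (Rel.braid (K := K) (n := n) (d := d)
      i (i + 1) ⟨hi, by omega⟩ ⟨by omega, hin⟩ (Or.inl rfl))
  comm i j hi hij hj := by
    simpa [T] using RingQuot.mkAlgHom_rel (RatFunc K) (Rel.comm (K := K) (n := n) (d := d)
      i j ⟨hi, by omega⟩ ⟨by omega, hj⟩ (Or.inl hij))
  f_comm i j hi hin hj hjn := by
    have := RingQuot.mkAlgHom_rel (RatFunc K) (Rel.F_comm (K := K) (n := n) (d := d)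
      i j ⟨hi, hin⟩ ⟨hj, hjn⟩)
    rwa [map_mul, map_mul] at this
  t_f i j hi hin hj hjn := by
    simpa [T, F] using RingQuot.mkAlgHom_rel (RatFunc K) (Rel.T_F (K := K) (n := n) (d := d)
      i j ⟨hi, hin⟩ ⟨hj, hjn⟩)
  quad i hi hin := by
    have := RingQuot.mkAlgHom_rel (RatFunc K) (Rel.quadratic (K := K) (n := n) (d := d)
      i ⟨hi, hin⟩)
    set E : RY K n d := RingQuot.mkAlgHom (RatFunc K) (Rel K n d) (freeE K n d i) with hE
    -- The coefficient is polynomial in the two framing generators, because the inverse in `E_i` is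
    -- written as the power `d - k`.
    refine ⟨(RatFunc.X - 1 : RatFunc K) • (F K n d i ^ ((d ^ 2 - d) / 2) * E), ?_, ?_⟩
    · set B := Algebra.adjoin (RatFunc K) {F K n d i, F K n d (i + 1)}
      have h1 : F K n d i ∈ B := Algebra.subset_adjoin (Set.mem_insert _ _)
      have h2 : F K n d (i + 1) ∈ B := Algebra.subset_adjoin (Set.mem_insert_of_mem _ rfl)
      refine Subalgebra.smul_mem _ (mul_mem (pow_mem h1 _) ?_) _
      rw [hE, freeE, map_smul, map_sum]
      refine Subalgebra.smul_mem _ (sum_mem fun j _ => ?_) _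
      rw [map_mul, map_pow, map_pow]
      exact mul_mem (pow_mem h1 _) (pow_mem h2 _)
    · rw [map_pow, map_add, map_smul, map_mul, map_mul, map_pow, AlgHom.commutes] at this
      rw [← sq, smul_mul_assoc]
      exact this
  f_N i hi hin := by
    simpa [F, N] using RingQuot.mkAlgHom_rel (RatFunc K) (Rel.F_N (K := K) (n := n) (d := d)
      i ⟨hi, hin⟩)
  N_f_one := by
    simpa [F, N] using RingQuot.mkAlgHom_rel (RatFunc K) (Rel.N_F_one (K := K) (n := n) (d := d))
  f_last_N := by
    simpa [F, N] using RingQuot.mkAlgHom_rel (RatFunc K) (Rel.F_last_N (K := K) (n := n) (d := d))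
  N_pow_t i hi hin := by
    have := RingQuot.mkAlgHom_rel (RatFunc K) (Rel.N_pow_T (K := K) (n := n) (d := d) i ⟨hi, hin⟩)
    rwa [map_mul, map_smul, map_pow] at this
  t_N_pow i hi hin := by
    have := RingQuot.mkAlgHom_rel (RatFunc K) (Rel.T_N_pow (K := K) (n := n) (d := d) i ⟨hi, hin⟩)
    rwa [map_mul, map_smul, map_pow] at this
  t_N i hi hin := by
    simpa [T, N] using RingQuot.mkAlgHom_rel (RatFunc K) (Rel.T_N (K := K) (n := n) (d := d)
      i ⟨hi, hin⟩)
  N_t_N := by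
    have := RingQuot.mkAlgHom_rel (RatFunc K) (Rel.N_T_N (K := K) (n := n) (d := d))
    rwa [map_mul, map_mul, map_smul, map_list_prod, List.map_map] at this

theorem adjoin_generators :
    Algebra.adjoin (RatFunc K)
      (T K n d '' Set.Ico 1 n ∪ F K n d '' Set.Icc 1 n ∪ {N K n d}) = ⊤ := by
  have h1 : (RingQuot.mkAlgHom (RatFunc K) (Rel K n d)).range = ⊤ :=
    (AlgHom.range_eq_top _).2 (RingQuot.mkAlgHom_surjective _ _)
  rw [← top_le_iff, ← h1, ← Algebra.map_top, ← FreeAlgebra.adjoin_range_ι, AlgHom.map_adjoin]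
  refine Algebra.adjoin_mono ?_
  rintro _ ⟨_, ⟨g, rfl⟩, rfl⟩
  cases g with
  | T i hi => exact Or.inl (Or.inl ⟨i, hi, by simp [T, freeT, hi.1, hi.2]⟩)
  | F i hi => exact Or.inl (Or.inr ⟨i, hi, by simp [F, freeF, hi.1, hi.2]⟩)
  | N => exact Or.inr rfl

variable {K n d}

theorem Fm_snoc {r : ℕ} (m : Fin r → ZMod d) (e : ZMod d) :
    Fm K n d (Fin.snoc m e : Fin (r + 1) → ZMod d) = Fm K n d m * F K n d (r + 1) ^ e.val := by
  rw [Fm, List.ofFn_succ', List.concat_eq_append, List.prod_append]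
  simp [Fm]

/-- The `F_j` commute and have order dividing `d`, so right multiplication by one of them only
raises one exponent modulo `d`. -/
theorem mem_span_Fm [NeZero d] {r : ℕ} (hr : r ≤ n) {x : RY K n d}
    (hx : x ∈ framing (RatFunc K) (F K n d) r) :
    x ∈ Submodule.span (RatFunc K) (Set.range fun m : Fin r → ZMod d => Fm K n d m) := by
  have closed : ∀ r ≤ n, ∀ m : Fin r → ZMod d, ∀ j, 1 ≤ j → j ≤ r →
      ∃ m' : Fin r → ZMod d, Fm K n d m * F K n d j = Fm K n d m' := by
    intro r
    induction r with
    | zero => intro _ _ j _ _; omega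
    | succ r ih =>
      intro hr m j hj hjr
      rw [← Fin.snoc_init_self m, Fm_snoc]
      rcases hjr.eq_or_lt with rfl | hjr
      · refine ⟨Fin.snoc (Fin.init m) (m (Fin.last r) + 1), ?_⟩
        rw [Fm_snoc, mul_assoc, ← pow_succ]
        congr 1
        refine pow_eq_pow_of_modEq ?_ (F_pow_d K n d hj hr)
        rw [← ZMod.natCast_eq_natCast_iff]
        simp
      · obtain ⟨m', e⟩ := ih (by omega) (Fin.init m) j hj (by omega)
        refine ⟨Fin.snoc m' (m (Fin.last r)), ?_⟩
        rw [Fm_snoc, ← e, mul_assoc, mul_assoc,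
          (((isRook K n d).f_comm (r + 1) j (by omega) hr hj (by omega)).pow_left _).eq]
  rw [← one_mul x]
  refine mul_mem_of_adjoin_right ?_ (Submodule.subset_span ⟨0, ?_⟩) hx
  · rintro v hv _ ⟨j, ⟨hj, hjr⟩, rfl⟩
    refine map_mem_of_span (LinearMap.mulRight _ (F K n d j)) ?_ hv
    rintro _ ⟨m, rfl⟩
    obtain ⟨m', e⟩ := closed r hr m j hj hjr
    exact Submodule.subset_span ⟨m', e.symm⟩
  · simp [Fm]

/-- The simple transpositions of `Fin r`, numbered from one. -/
def simpleNat (r i : ℕ) : Equiv.Perm (Fin r) :=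
  if h : i - 1 < r - 1 then simple r ⟨i - 1, h⟩ else 1

theorem simpleNat_succ {r : ℕ} (i : Fin (r - 1)) : simpleNat r (i + 1) = simple r i := by
  simp [simpleNat]

theorem swap_braid {α : Type*} [DecidableEq α] {a b c : α} (hab : a ≠ b) (hac : a ≠ c)
    (hbc : b ≠ c) : Equiv.swap a b * Equiv.swap b c * Equiv.swap a b
      = Equiv.swap b c * Equiv.swap a b * Equiv.swap b c := by
  rw [Equiv.swap_mul_swap_mul_swap hab hac, Equiv.swap_comm a b, Equiv.swap_comm b c,
    Equiv.swap_mul_swap_mul_swap hbc.symm hac.symm, Equiv.swap_comm]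

theorem swap_commute {α : Type*} [DecidableEq α] {a b c e : α} (h : [a, b, c, e].Nodup) :
    Equiv.swap a b * Equiv.swap c e = Equiv.swap c e * Equiv.swap a b :=
  (Equiv.Perm.disjoint_swap_swap h).commute.eq

theorem isBraid_simpleNat (r : ℕ) : IsBraid r (simpleNat r) where
  braid i hi hir := by
    obtain ⟨i, rfl⟩ : ∃ j, i = j + 1 := ⟨i - 1, by omega⟩
    rw [simpleNat, simpleNat, dif_pos (by omega), dif_pos (by omega)]
    refine swap_braid ?_ ?_ ?_ <;> (simp [Fin.ext_iff]; try omega)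
  comm i j hi hij hj := by
    rw [simpleNat, simpleNat, dif_pos (by omega), dif_pos (by omega)]
    refine swap_commute ?_
    simp [Fin.ext_iff]
    omega

/-- Every chosen reduced expression has the same T-product as some normal form. This gives an
injection of the symmetric group into the normal forms, of which there are at most `r!`, so it is
onto and every normal form arises. -/
theorem exists_Tperm_eq {r : ℕ} (hr : r ≤ n) {w : List ℕ} (hw : w ∈ normalForms r) :
    ∃ ω : Equiv.Perm (Fin r), Tperm K n d ω = wordProd (T K n d) w := by
  have key : ∀ ω : Equiv.Perm (Fin r), ∃ v ∈ normalForms r, wordProd (simpleNat r) v = ω ∧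
      wordProd (T K n d) v = Tperm K n d ω := by
    intro ω
    obtain ⟨l1, l2⟩ := (exists_isReducedExpr ω).choose_spec
    set l := (exists_isReducedExpr ω).choose with hl
    obtain ⟨v, hv, h1, h2, h3⟩ := ((isRook K n d).toIsBraid.mono hr).exists_normalForm
      (isBraid_simpleNat r) (fun i hi hir => by
        have : i - 1 < r - 1 := by omega
        simp only [simpleNat, this, dif_pos, simple]
        exact Equiv.swap_mul_self _ _) (l.map fun i : Fin (r - 1) => (i : ℕ) + 1) (by
        intro i hi
        obtain ⟨j, -, rfl⟩ := List.mem_map.1 hi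
        omega)
    have e1 : wordProd (simpleNat r) (l.map fun i : Fin (r - 1) => (i : ℕ) + 1) = ω := by
      rw [← l1, wordProd, List.map_map]
      congr 1
      exact List.map_congr_left fun i _ => simpleNat_succ i
    have e2 : wordProd (T K n d) (l.map fun i : Fin (r - 1) => (i : ℕ) + 1) = Tperm K n d ω := by
      rw [Tperm, wordProd, List.map_map]
      simp only [bind_pure_comp, List.map_eq_map, List.map_map]
      rfl
    refine ⟨v, hv, h2.trans e1, (h3 ?_).trans e2⟩
    rw [List.length_map] at h1 ⊢
    refine le_antisymm h1 ?_
    have hv' : ∀ i ∈ v, 1 ≤ i ∧ i < r := fun i hi => mem_of_mem_normalForms hv hi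
    -- To use the minimality of `l`, the normal form is turned back into a word in `Fin (r - 1)`; it
    -- cannot be shorter than `l`, so no step shortened the word.
    have e3 : (v.pmap (fun i hi => (⟨i - 1, by omega⟩ : Fin (r - 1))) hv').map (simple r)
        = v.map (simpleNat r) := by
      rw [List.map_pmap]
      rw [← List.pmap_eq_map (p := fun i => 1 ≤ i ∧ i < r) (H := hv')]
      refine List.pmap_congr_left _ fun i _ hi _ => ?_
      simp [simpleNat, show i - 1 < r - 1 by omega]
    have := l2 (v.pmap (fun i hi => (⟨i - 1, by omega⟩ : Fin (r - 1))) hv')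
      (by rw [e3]; exact h2.trans e1)
    simpa using this
  choose v hv h1 h2 using key
  have inj : Function.Injective v := fun a b hab => by rw [← h1 a, ← h1 b, hab]
  have : Finset.univ.image v = normalForms r := by
    refine Finset.eq_of_subset_of_card_le (fun x hx => ?_) ?_
    · obtain ⟨ω, -, rfl⟩ := Finset.mem_image.1 hx
      exact hv ω
    · rw [Finset.card_image_of_injective _ inj, Finset.card_univ, Fintype.card_perm,
        Fintype.card_fin]
      exact card_normalForms_le r
  rw [← this] at hw
  obtain ⟨ω, -, rfl⟩ := Finset.mem_image.1 hw
  exact ⟨ω, (h2 ω).symm⟩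

section Words

variable {M : Type*} [Monoid M]

theorem lowProd_eq_ofFn (t : ℕ → M) (l : ℕ) (as : List ℕ) :
    lowProd t l as
      = (List.ofFn fun i : Fin as.length => seg t as[i] (l + (i + 1))).prod := by
  induction as generalizing l with
  | nil => simp [lowProd]
  | cons a as ih =>
    rw [lowProd, ih, List.ofFn_succ, List.prod_cons]
    simp [add_comm, add_left_comm]

theorem highProd_eq_ofFn (t : ℕ → M) (l : ℕ) (as : List ℕ) :
    highProd t l as
      = (List.ofFn fun i : Fin as.length => seg t (l + (i + 1)) as[i]).prod := by
  induction as generalizing l with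
  | nil => simp [highProd]
  | cons a as ih =>
    rw [highProd, ih, List.ofFn_succ, List.prod_cons]
    simp [add_comm, add_left_comm]

theorem lowProd_append (t : ℕ → M) (l : ℕ) (as : List ℕ) (a : ℕ) :
    lowProd t l (as ++ [a]) = lowProd t l as * seg t a (l + as.length + 1) := by
  induction as generalizing l with
  | nil => simp [lowProd]
  | cons b as ih =>
    rw [List.cons_append, lowProd, ih, lowProd, mul_assoc, List.length_cons,
      show l + 1 + as.length = l + (as.length + 1) by omega]

theorem unop_seg_rev (t : ℕ → M) (n : ℕ) {a j : ℕ} (hja : j ≤ a) (ha : a ≤ n) :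
    unop (seg (fun i => op (t (n - i))) a j) = seg t (n + 1 - j) (n + 1 - a) := by
  induction a, hja using Nat.le_induction with
  | base => simp
  | succ a hja ih =>
    rw [seg_succ _ hja, unop_mul, ih (by omega), unop_op,
      seg_succ_right t (by omega : n + 1 - (a + 1) < n + 1 - j),
      show n + 1 - (a + 1) = n - a by omega, show n - a + 1 = n + 1 - a by omega]

/-- The mirror image of `T_A` is `T̄_B`, where `B` is the image of `A` under `b ↦ n + 1 - b`; this
identifies the right factors found by the reversal. -/
theorem unop_lowProd (t : ℕ → M) {n m : ℕ} {bs : List ℕ} (hbs : IncrIn m n bs)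
    (h : m + bs.length ≤ n) :
    unop (lowProd (fun i => op (t (n - i))) 0 (bs.map (n + 1 - ·)).reverse)
      = highProd t (n - bs.length) bs := by
  induction bs generalizing m with
  | nil => simp [lowProd, highProd]
  | cons b bs ih =>
    obtain ⟨h1, h2, h3⟩ := IncrIn.cons_iff.1 hbs
    have h4 := h3.length_le
    rw [List.length_cons] at h ⊢
    rw [List.map_cons, List.reverse_cons, lowProd_append, unop_mul, ih (h3.mono h1) (by omega),
      highProd, zero_add, List.length_reverse, List.length_map,
      unop_seg_rev t n (by omega) (by omega),
      show n + 1 - (n + 1 - b) = b by omega,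
      show n + 1 - (bs.length + 1) = n - (bs.length + 1) + 1 by omega,
      show n - (bs.length + 1) + 1 = n - bs.length by omega]

end Words

theorem ofFn_orderEmbOfFin {M : Type*} (A : Finset ℕ) (g : ℕ → ℕ → M) :
    (List.ofFn fun i : Fin A.card => g i (A.orderEmbOfFin rfl i))
      = List.ofFn fun i : Fin A.sort.length => g i A.sort[i] := by
  apply List.ext_getElem
  · simp
  · intro i h1 h2
    simp [Finset.orderEmbOfFin_apply]

theorem TA_eq (A : Finset ℕ) : TA K n d A = lowProd (T K n d) 0 A.sort := by
  rw [lowProd_eq_ofFn, TA]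
  simp only [zero_add]
  rw [← ofFn_orderEmbOfFin A fun i a => seg (T K n d) a (i + 1)]
  rfl

theorem TAbar_eq (A : Finset ℕ) :
    TAbar K n d A = highProd (T K n d) (n - A.card) A.sort := by
  rw [highProd_eq_ofFn, TAbar]
  rw [← ofFn_orderEmbOfFin A fun i a => seg (T K n d) (n - A.card + (i + 1)) a]
  rfl

theorem IncrIn.sort_toFinset {m n : ℕ} {as : List ℕ} (h : IncrIn m n as) :
    as.toFinset.sort = as :=
  (List.toFinset_sort _ (h.1.imp fun h => h.ne)).2 (h.1.imp fun h => h.le)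

theorem IncrIn.toFinset_subset {n : ℕ} {as : List ℕ} (h : IncrIn 0 n as) :
    as.toFinset ⊆ Finset.Icc 1 n := fun a ha => by
  have := h.2 a (List.mem_toFinset.1 ha)
  exact Finset.mem_Icc.2 ⟨this.1, this.2⟩

theorem IncrIn.card_toFinset {m n : ℕ} {as : List ℕ} (h : IncrIn m n as) :
    as.toFinset.card = as.length :=
  List.toFinset_card_of_nodup (h.1.imp fun h => h.ne)

theorem IncrIn.reverse_map {n : ℕ} {as : List ℕ} (h : IncrIn 0 n as) :
    IncrIn 0 n (as.map (n + 1 - ·)).reverse := by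
  refine ⟨?_, fun a ha => ?_⟩
  · rw [List.pairwise_reverse, List.pairwise_map]
    refine h.1.imp_of_mem fun ha hb hab => ?_
    have := (h.2 _ ha); have := (h.2 _ hb)
    omega
  · rw [List.mem_reverse, List.mem_map] at ha
    obtain ⟨b, hb, rfl⟩ := ha
    have := h.2 b hb
    omega

/-- The set `C_n` spans the Rook Yokonuma--Hecke algebra. -/
theorem span_C (hn : 1 ≤ n) (hd : 1 ≤ d) : Submodule.span (RatFunc K) (C K n d) = ⊤ := by
  have : NeZero d := ⟨by omega⟩
  rw [← top_le_iff, ← (isRook K n d).span_standardSet RatFunc.X_ne_zero hn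
    (adjoin_generators K n d), Submodule.span_le]
  refine Set.iUnion₂_subset fun m (hm : m ≤ n) => ?_
  rintro _ ⟨as, bs, has, hal, hbs, hbl, y, hy, w, hw, rfl⟩
  set g := N K n d ^ m * unop (lowProd (fun i => op (T K n d (n - i))) 0 bs) with hg
  have key := map_mem_of_span (V := Submodule.span (RatFunc K) (C K n d))
    ((LinearMap.mulLeft (RatFunc K) (lowProd (T K n d) 0 as)).comp
      (LinearMap.mulRight (RatFunc K) (wordProd (T K n d) w * g))) ?_
      (mem_span_Fm (by omega) hy)
  · simpa only [hg, LinearMap.comp_apply, LinearMap.mulLeft_apply, LinearMap.mulRight_apply,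
      mul_assoc, SetLike.mem_coe] using key
  · rintro _ ⟨q, rfl⟩
    obtain ⟨ω, hω⟩ := exists_Tperm_eq (K := K) (n := n) (d := d) (by omega) hw
    have hbs' := hbs.reverse_map
    -- The reflection `b ↦ n + 1 - b` is an involution on lists with entries in `1, …, n`.
    have hbb : bs = ((bs.map (n + 1 - ·)).reverse.map (n + 1 - ·)).reverse := by
      rw [List.map_reverse, List.reverse_reverse, List.map_map]
      conv_lhs => rw [← List.map_id bs]
      refine List.map_congr_left fun b hb => ?_
      have := hbs.2 b hb
      simp only [id, Function.comp_apply]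
      omega
    have eA : TA K n d as.toFinset = lowProd (T K n d) 0 as := by
      rw [TA_eq, has.sort_toFinset]
    have eB : TAbar K n d (bs.map (n + 1 - ·)).reverse.toFinset
        = unop (lowProd (fun i => op (T K n d (n - i))) 0 bs) := by
      have := hbs'.length_le
      rw [TAbar_eq, hbs'.sort_toFinset, hbs'.card_toFinset,
        ← unop_lowProd (T K n d) hbs' (by omega), ← hbb]
    refine Submodule.subset_span (Set.mem_biUnion (x := n - m)
      (Finset.mem_coe.2 (Finset.mem_range.2 (by omega))) ?_)
    refine ⟨as.toFinset, _, has.toFinset_subset, hbs'.toFinset_subset,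
      has.card_toFinset.trans hal, hbs'.card_toFinset.trans (by simpa using hbl), q, ω, ?_⟩
    rw [eA, eB, hω, show n - (n - m) = m by omega]
    simp only [hg, LinearMap.comp_apply, LinearMap.mulLeft_apply, LinearMap.mulRight_apply,
      mul_assoc]

end Span
end RookYH
end

/-! ### The representation on functions of coloured words -/

noncomputable section
namespace RookYH

section Representation

variable {L : Type*} [Field L]

/-- The operator of `T_i` on functions of words `x 1, x 2, …`, with parameters `u`, `g` and `τ`. -/
def opT (u : L) (g : ℕ → ℕ → L) (τ : ℕ → L) (i : ℕ) : Module.End L ((ℕ → ℕ) → L) where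
  toFun f x :=
    (if x i < x (i + 1) then u else if x i = x (i + 1) then 0 else 1)
        * f (x ∘ Equiv.swap i (i + 1)) +
      (if x i < x (i + 1) then 0 else if x i = x (i + 1) then τ (x i)
        else (u - 1) * g (x i) (x (i + 1))) * f x
  map_add' f f' := by ext x; simp only [Pi.add_apply]; ring
  map_smul' a f := by ext x; simp only [Pi.smul_apply, smul_eq_mul, RingHom.id_apply]; ring

theorem opT_apply (u : L) (g : ℕ → ℕ → L) (τ : ℕ → L) (i : ℕ) (f : (ℕ → ℕ) → L) (x : ℕ → ℕ) :
    opT u g τ i f x = (if x i < x (i + 1) then u else if x i = x (i + 1) then 0 else 1)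
        * f (x ∘ Equiv.swap i (i + 1)) +
      (if x i < x (i + 1) then 0 else if x i = x (i + 1) then τ (x i)
        else (u - 1) * g (x i) (x (i + 1))) * f x := rfl

/-- The operator of `F_i`. -/
def opF (c : ℕ → L) (i : ℕ) : Module.End L ((ℕ → ℕ) → L) where
  toFun f x := c (x i) * f x
  map_add' f f' := by ext x; simp only [Pi.add_apply]; ring
  map_smul' a f := by ext x; simp only [Pi.smul_apply, smul_eq_mul, RingHom.id_apply]; ring

theorem opF_apply (c : ℕ → L) (i : ℕ) (f : (ℕ → ℕ) → L) (x : ℕ → ℕ) :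
    opF c i f x = c (x i) * f x := rfl

/-- The word `x 1, …, x n` shifted to the right by `m` places and filled up with zeros. -/
def shift (n m : ℕ) (x : ℕ → ℕ) (p : ℕ) : ℕ := if m = 0 ∨ (m < p ∧ p ≤ n) then x (p - m) else 0

/-- The separate clause for `m = 0` makes this an identity at all positions, including those outside
`1, …, n`. -/
theorem shift_zero (n : ℕ) (x : ℕ → ℕ) : shift n 0 x = x := by ext p; simp [shift]

theorem shift_apply {n m : ℕ} (hm : 1 ≤ m) (x : ℕ → ℕ) (p : ℕ) :
    shift n m x p = if m < p ∧ p ≤ n then x (p - m) else 0 := by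
  simp [shift, show m ≠ 0 by omega]

open Classical in
/-- The operator of `N`. -/
def opN (c : ℕ → L) (n : ℕ) : Module.End L ((ℕ → ℕ) → L) where
  toFun f x := if c (x n) = 1 then f (shift n 1 x) else 0
  map_add' f f' := by ext x; simp only [Pi.add_apply]; split_ifs <;> simp
  map_smul' a f := by ext x; simp

open Classical in
theorem opN_apply (c : ℕ → L) (n : ℕ) (f : (ℕ → ℕ) → L) (x : ℕ → ℕ) :
    opN c n f x = if c (x n) = 1 then f (shift n 1 x) else 0 := rfl

-- The letters tested by successive factors `N` are the last `m` letters of the original word; once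
-- these are used up the tested letters are inserted zeros, whose colour is 1.
open Classical in
theorem opN_pow_apply {c : ℕ → L} (hc0 : c 0 = 1) {n : ℕ} (hn : 1 ≤ n) (m : ℕ) (f : (ℕ → ℕ) → L) (x : ℕ → ℕ) :
    (opN c n ^ m) f x
      = if ∀ p, 1 ≤ p → n < p + m → p ≤ n → c (x p) = 1 then f (shift n m x) else 0 := by
  induction m generalizing x with
  | zero =>
    rw [if_pos fun p _ h1 h2 => by omega, pow_zero, Module.End.one_apply, shift_zero]
  | succ m ih =>
    rw [pow_succ', Module.End.mul_apply, opN_apply]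
    by_cases h : c (x n) = 1
    · rw [if_pos h, ih]
      have e : shift n m (shift n 1 x) = shift n (m + 1) x := by
        rcases Nat.eq_zero_or_pos m with rfl | hm
        · rw [shift_zero]
        · ext p
          simp only [shift_apply hm, shift_apply le_rfl, shift_apply (by omega : 1 ≤ m + 1)]
          split_ifs <;> first | rfl | exact congrArg x (by omega) | (exfalso; omega)
      rw [e]
      refine if_congr ⟨fun H p hp hp1 hp2 => ?_, fun H p hp hp1 hp2 => ?_⟩ rfl rfl
      · rcases hp2.eq_or_lt with rfl | hp2
        · exact h
        · simpa [shift, show 1 < p + 1 ∧ p + 1 ≤ n by omega] using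
            H (p + 1) (by omega) (by omega) (by omega)
      · rw [shift_apply le_rfl]
        split_ifs with h1
        · exact H (p - 1) (by omega) (by omega) (by omega)
        · exact hc0
    · rw [if_neg h, if_neg fun H => h (H n hn (by omega) le_rfl)]

theorem opT_sq {u : L} {g : ℕ → ℕ → L} {τ : ℕ → L} (gsymm : ∀ a b, g a b = g b a)
    (hτ : ∀ a, τ a * τ a = u + (u - 1) * g a a * τ a) (i : ℕ) (f : (ℕ → ℕ) → L) (x : ℕ → ℕ) :
    opT u g τ i (opT u g τ i f) x
      = u * f x + (u - 1) * (g (x i) (x (i + 1)) * opT u g τ i f x) := by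
  have e : (x ∘ Equiv.swap i (i + 1)) ∘ Equiv.swap i (i + 1) = x := by
    ext p; simp
  simp only [opT_apply, Function.comp_apply, Equiv.swap_apply_left, Equiv.swap_apply_right, e]
  rcases lt_trichotomy (x i) (x (i + 1)) with h | h | h
  · simp only [h, h.not_gt, h.ne', if_true, if_false, gsymm (x (i + 1))]
    ring
  · simp only [h, lt_irrefl, if_true, if_false]
    linear_combination (f x) * hτ (x (i + 1))
  · simp only [h, h.not_gt, h.ne', if_true, if_false]
    ring

/-- Both sides are expanded on the orbit of `x` under permutations of three neighbouring places, and
the coefficients are compared for each relative order of the three letters. `gmul` is the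
transitivity of having equal colours; `hτ` enters where two letters coincide. -/
theorem opT_braid {u : L} {g : ℕ → ℕ → L} {τ : ℕ → L} (gsymm : ∀ a b, g a b = g b a)
    (gmul : ∀ a b e, g a b * g b e = g a b * g a e)
    (hτ : ∀ a, τ a * τ a = u + (u - 1) * g a a * τ a) (i : ℕ) :
    opT u g τ i * opT u g τ (i + 1) * opT u g τ i
      = opT u g τ (i + 1) * opT u g τ i * opT u g τ (i + 1) := by
  ext f x
  have h1 : ∀ y : ℕ → ℕ, (y ∘ Equiv.swap i (i + 1)) ∘ Equiv.swap i (i + 1) = y := fun y => by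
    ext p; simp
  have h2 : ∀ y : ℕ → ℕ,
      (y ∘ Equiv.swap (i + 1) (i + 1 + 1)) ∘ Equiv.swap (i + 1) (i + 1 + 1) = y := fun y => by
    ext p; simp
  have h3 : ((x ∘ Equiv.swap i (i + 1)) ∘ Equiv.swap (i + 1) (i + 1 + 1)) ∘ Equiv.swap i (i + 1)
      = ((x ∘ Equiv.swap (i + 1) (i + 1 + 1)) ∘ Equiv.swap i (i + 1)) ∘
        Equiv.swap (i + 1) (i + 1 + 1) := by
    have := swap_braid (a := i) (b := i + 1) (c := i + 1 + 1) (by omega) (by omega) (by omega)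
    ext p
    exact congrArg x (Equiv.congr_fun this p)
  have s1 : Equiv.swap i (i + 1) (i + 1 + 1) = i + 1 + 1 :=
    Equiv.swap_apply_of_ne_of_ne (by omega) (by omega)
  have s2 : Equiv.swap (i + 1) (i + 1 + 1) i = i :=
    Equiv.swap_apply_of_ne_of_ne (by omega) (by omega)
  simp only [Module.End.mul_apply, opT_apply, Function.comp_apply, Equiv.swap_apply_left,
    Equiv.swap_apply_right, s1, s2, h1, h2, h3]
  generalize f x = f0
  generalize f (x ∘ Equiv.swap i (i + 1)) = f1
  generalize f (x ∘ Equiv.swap (i + 1) (i + 1 + 1)) = f2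
  generalize f ((x ∘ Equiv.swap i (i + 1)) ∘ Equiv.swap (i + 1) (i + 1 + 1)) = f12
  generalize f ((x ∘ Equiv.swap (i + 1) (i + 1 + 1)) ∘ Equiv.swap i (i + 1)) = f21
  generalize f (((x ∘ Equiv.swap (i + 1) (i + 1 + 1)) ∘ Equiv.swap i (i + 1)) ∘
        Equiv.swap (i + 1) (i + 1 + 1)) = f3
  generalize x i = a
  generalize x (i + 1) = b
  generalize x (i + 1 + 1) = e
  rcases lt_trichotomy a b with hab | rfl | hab
  · rcases lt_trichotomy b e with hbe | rfl | hbe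
    · have hae := hab.trans hbe
      simp only [hab, hab.not_gt, hab.ne, hab.ne', hbe, hbe.not_gt, hbe.ne, hbe.ne', hae, hae.ne, if_true, if_false]
      ring
    · simp only [hab, hab.not_gt, hab.ne, hab.ne', lt_irrefl, if_true, if_false]
      ring
    · rcases lt_trichotomy a e with hae | rfl | hae
      · simp only [hab, hab.not_gt, hab.ne, hab.ne', hbe, hbe.not_gt, hbe.ne, hbe.ne', hae, hae.ne, if_true, if_false]
        ring
      · simp only [hab, hab.not_gt, hab.ne, hab.ne', lt_irrefl, if_true, if_false]
        ring
      · simp only [hab, hab.not_gt, hab.ne, hab.ne', hbe, hbe.not_gt, hbe.ne, hbe.ne', hae.not_gt, hae.ne', if_true, if_false]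
        have m := gmul e a b
        rw [gsymm e a, gsymm a b, gsymm e b] at m
        linear_combination u * (u - 1) ^ 2 * f1 * m
  · rcases lt_trichotomy a e with hae | rfl | hae
    · simp only [hae, hae.not_gt, hae.ne, hae.ne', lt_irrefl, if_true, if_false]
      ring
    · simp only [lt_irrefl, if_true, if_false]
      ring
    · simp only [hae, hae.not_gt, hae.ne, hae.ne', lt_irrefl, if_true, if_false]
      have m := gmul e a a
      rw [gsymm e a] at m
      linear_combination (u - 1) * g a e * f0 * hτ a + (u - 1) ^ 2 * f0 * τ a * m
  · rcases lt_trichotomy b e with hbe | rfl | hbe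
    · rcases lt_trichotomy a e with hae | rfl | hae
      · simp only [hab, hab.not_gt, hab.ne, hab.ne', hbe, hbe.not_gt, hbe.ne, hbe.ne', hae, hae.ne, if_true, if_false]
        ring
      · simp only [hab, hab.not_gt, hab.ne, hab.ne', lt_irrefl, if_true, if_false]
        ring
      · simp only [hab, hab.not_gt, hab.ne, hab.ne', hbe, hbe.not_gt, hbe.ne, hbe.ne', hae.not_gt, hae.ne', if_true, if_false]
        linear_combination -u * (u - 1) ^ 2 * f2 * gmul a e b
    · simp only [hab, hab.not_gt, hab.ne, hab.ne', lt_irrefl, if_true, if_false]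
      linear_combination -(u - 1) * g a b * f0 * hτ b - (u - 1) ^ 2 * f0 * τ b * gmul a b b
    · have hae := hbe.trans hab
      simp only [hab, hab.not_gt, hab.ne, hab.ne', hbe, hbe.not_gt, hbe.ne, hbe.ne', hae.not_gt, hae.ne', if_true, if_false]
      have m := gmul b e a
      rw [gsymm b a, gsymm e a] at m
      linear_combination -(u - 1) ^ 2 * f1 * m - (u - 1) ^ 2 * f2 * gmul a b e
        - (u - 1) ^ 3 * f0 * (g a b * m + g b e * gmul a b e)

theorem opT_comm (u : L) (g : ℕ → ℕ → L) (τ : ℕ → L) {i j : ℕ} (h : i + 1 < j) :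
    opT u g τ i * opT u g τ j = opT u g τ j * opT u g τ i := by
  ext f x
  have e : (x ∘ Equiv.swap i (i + 1)) ∘ Equiv.swap j (j + 1)
      = (x ∘ Equiv.swap j (j + 1)) ∘ Equiv.swap i (i + 1) := by
    have := swap_commute (a := i) (b := i + 1) (c := j) (e := j + 1) (by simp; omega)
    ext p
    exact congrArg x (Equiv.congr_fun this p)
  have s1 : Equiv.swap i (i + 1) j = j := Equiv.swap_apply_of_ne_of_ne (by omega) (by omega)
  have s2 : Equiv.swap i (i + 1) (j + 1) = j + 1 :=
    Equiv.swap_apply_of_ne_of_ne (by omega) (by omega)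
  have s3 : Equiv.swap j (j + 1) i = i := Equiv.swap_apply_of_ne_of_ne (by omega) (by omega)
  have s4 : Equiv.swap j (j + 1) (i + 1) = i + 1 :=
    Equiv.swap_apply_of_ne_of_ne (by omega) (by omega)
  simp only [Module.End.mul_apply, opT_apply, Function.comp_apply, s1, s2, s3, s4, e]
  ring

theorem opT_mul_opF {u : L} {g : ℕ → ℕ → L} {τ c : ℕ → L} (hgc : ∀ a b, g a b * c a = g a b * c b)
    (i j : ℕ) : opT u g τ i * opF c j = opF c (Equiv.swap i (i + 1) j) * opT u g τ i := by
  ext f x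
  simp only [Module.End.mul_apply, opT_apply, opF_apply, Function.comp_apply]
  rcases eq_or_ne j i with rfl | h1
  · rw [Equiv.swap_apply_left]
    split_ifs with h h'
    · ring
    · rw [h']; ring
    · linear_combination (u - 1) * f x * hgc (x j) (x (j + 1))
  rcases eq_or_ne j (i + 1) with rfl | h2
  · rw [Equiv.swap_apply_right]
    split_ifs with h h'
    · ring
    · rw [h']; ring
    · linear_combination -(u - 1) * f x * hgc (x i) (x (i + 1))
  rw [Equiv.swap_apply_of_ne_of_ne h1 h2]
  ring

theorem opF_mul_opN (c : ℕ → L) {n i : ℕ} (hi : 1 ≤ i) (hin : i < n) :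
    opF c i * opN c n = opN c n * opF c (i + 1) := by
  ext f x
  simp only [Module.End.mul_apply, opN_apply, opF_apply]
  have : shift n 1 x (i + 1) = x i := by simp [shift, show 1 < i + 1 ∧ i + 1 ≤ n by omega]
  rw [this, mul_ite, mul_zero]

theorem opN_mul_opF_one {c : ℕ → L} (hc0 : c 0 = 1) (n : ℕ) : opN c n * opF c 1 = opN c n := by
  ext f x
  simp [Module.End.mul_apply, opN_apply, opF_apply, shift, hc0]

theorem opF_last_mul_opN (c : ℕ → L) (n : ℕ) : opF c n * opN c n = opN c n := by
  ext f x
  simp only [Module.End.mul_apply, opN_apply, opF_apply]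
  split_ifs with h <;> simp [h]

theorem opN_pow_mul_opT {u : L} {g : ℕ → ℕ → L} {τ c : ℕ → L} (hc0 : c 0 = 1) (hτ : τ 0 = u)
    {n i : ℕ} (hn : 1 ≤ n) : opN c n ^ (i + 1) * opT u g τ i = u • opN c n ^ (i + 1) := by
  ext f x
  simp only [Module.End.mul_apply, LinearMap.smul_apply, Pi.smul_apply, opN_pow_apply hc0 hn]
  have h1 : shift n (i + 1) x i = 0 := by simp [shift]
  have h2 : shift n (i + 1) x (i + 1) = 0 := by simp [shift]
  split_ifs
  · simp [opT_apply, h1, h2, hτ]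
  · simp

/-- The power of `N` forgets the letters from place `i` on after checking their colours, so it takes
the same value at a word and at its swap. When both colours are 1 the two coefficients of `T_i` add
up to `u` for every order of the letters. -/
theorem opT_mul_opN_pow {u : L} {g : ℕ → ℕ → L} {τ c : ℕ → L} (hc0 : c 0 = 1)
    (hτ : ∀ a, c a = 1 → τ a = u) (hg : ∀ a b, c a = 1 → c b = 1 → g a b = 1)
    {n i : ℕ} (hi : 1 ≤ i) (hin : i < n) :
    opT u g τ i * opN c n ^ (n - i + 1) = u • opN c n ^ (n - i + 1) := by
  classical
  ext f x
  simp only [Module.End.mul_apply, LinearMap.smul_apply, Pi.smul_apply, opT_apply,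
    opN_pow_apply hc0 (by omega : 1 ≤ n)]
  have e1 : shift n (n - i + 1) (x ∘ Equiv.swap i (i + 1)) = shift n (n - i + 1) x := by
    ext p
    simp only [shift_apply (by omega : 1 ≤ n - i + 1)]
    split_ifs
    · rw [Function.comp_apply, Equiv.swap_apply_of_ne_of_ne (by omega) (by omega)]
    · rfl
  have e2 : (∀ p, 1 ≤ p → n < p + (n - i + 1) → p ≤ n →
        c ((x ∘ Equiv.swap i (i + 1)) p) = 1) ↔
      ∀ p, 1 ≤ p → n < p + (n - i + 1) → p ≤ n → c (x p) = 1 := by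
    constructor <;> intro H p h1 h2 h3
    · have := H (Equiv.swap i (i + 1) p)
      rw [Function.comp_apply, Equiv.swap_apply_self] at this
      refine this ?_ ?_ ?_ <;> rw [Equiv.swap_apply_def] <;> split_ifs <;> omega
    · refine H _ ?_ ?_ ?_ <;> rw [Equiv.swap_apply_def] <;> split_ifs <;> omega
  rw [e1, if_congr e2 rfl rfl]
  by_cases H : ∀ p, 1 ≤ p → n < p + (n - i + 1) → p ≤ n → c (x p) = 1
  · have c1 := H i hi (by omega) (by omega)
    have c2 := H (i + 1) (by omega) (by omega) (by omega)
    simp only [if_pos H, smul_eq_mul]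
    rcases lt_trichotomy (x i) (x (i + 1)) with h | h | h
    · simp only [h, if_true]; ring
    · simp only [h, lt_irrefl, if_true, if_false, hτ _ c2]; ring
    · simp only [h.not_gt, h.ne', if_false, hg _ _ c1 c2]; ring
  · simp only [if_neg H, mul_zero, smul_zero, add_zero]

theorem opT_mul_opN (u : L) (g : ℕ → ℕ → L) (τ c : ℕ → L) {n i : ℕ} (hi : 1 ≤ i)
    (hin : i + 1 < n) : opT u g τ i * opN c n = opN c n * opT u g τ (i + 1) := by
  classical
  ext f x
  simp only [Module.End.mul_apply, opT_apply, opN_apply]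
  have h1 : shift n 1 x (i + 1) = x i := by simp [shift, show 1 < i + 1 ∧ i + 1 ≤ n by omega]
  have h2 : shift n 1 x (i + 1 + 1) = x (i + 1) := by
    simp [shift, show 1 < i + 1 + 1 ∧ i + 1 + 1 ≤ n by omega]
  have h3 : (x ∘ Equiv.swap i (i + 1)) n = x n := by
    rw [Function.comp_apply, Equiv.swap_apply_of_ne_of_ne (by omega) (by omega)]
  have h4 : shift n 1 (x ∘ Equiv.swap i (i + 1))
      = shift n 1 x ∘ Equiv.swap (i + 1) (i + 1 + 1) := by
    ext p
    simp only [shift_apply le_rfl, Function.comp_apply, Equiv.swap_apply_def]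
    split_ifs <;> first | rfl | exact congrArg x (by omega) | (exfalso; omega)
  rw [h1, h2, h3, h4]
  by_cases h : c (x n) = 1
  · simp only [h, if_true]
  · simp only [h, if_false]; ring

/-- Zero is the smallest letter, so each generator carries it one place to the right with a factor
`u`. If the next letter is also zero, the diagonal entry `τ 0 = u` agrees with this rule. -/
theorem opT_ascending {u : L} {g : ℕ → ℕ → L} {τ : ℕ → L} (hτ : τ 0 = u) (f : (ℕ → ℕ) → L)
    (m : ℕ) {j : ℕ} {x : ℕ → ℕ} (hx : x j = 0) :
    wordProd (opT u g τ) (List.range' j m) f x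
      = u ^ m * f fun p => if j ≤ p ∧ p < j + m then x (p + 1) else if p = j + m then 0 else x p := by
  induction m generalizing j x with
  | zero =>
    simp only [List.range'_zero, wordProd, List.map_nil, List.prod_nil, Module.End.one_apply,
      pow_zero, one_mul]
    congr 1
    ext p
    split_ifs <;> first | omega | simp_all
  | succ m ih =>
    rw [List.range'_succ]
    have e : wordProd (opT u g τ) (j :: List.range' (j + 1) m)
        = opT u g τ j * wordProd (opT u g τ) (List.range' (j + 1) m) := by simp [wordProd]
    have key : ∀ h : (ℕ → ℕ) → L, opT u g τ j h x = u * h (x ∘ Equiv.swap j (j + 1)) := by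
      intro h
      rw [opT_apply, hx]
      rcases Nat.eq_zero_or_pos (x (j + 1)) with h0 | h0
      · have : x ∘ Equiv.swap j (j + 1) = x := by
          ext p
          rw [Function.comp_apply, Equiv.swap_apply_def]
          split_ifs with h1 h2
          · rw [h1, h0, hx]
          · rw [h2, h0, hx]
          · rfl
        simp [h0, hτ, this]
      · simp [h0]
    rw [e, Module.End.mul_apply, key, ih (by simp [hx]), pow_succ', mul_assoc]
    congr 3
    ext p
    simp only [Function.comp_apply, Equiv.swap_apply_def]
    split_ifs <;> first | rfl | exact congrArg x (by omega) | (exfalso; omega)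

theorem opN_mul_opT_mul_opN {u : L} {g : ℕ → ℕ → L} {τ c : ℕ → L} (hτ : τ 0 = u) (hc0 : c 0 = 1)
    {n : ℕ} (hn : 1 ≤ n) :
    opN c n * wordProd (opT u g τ) (List.range' 1 (n - 1)) * opN c n = u ^ (n - 1) • opN c n := by
  classical
  ext f x
  rw [Module.End.mul_apply, Module.End.mul_apply, opN_apply, LinearMap.smul_apply, Pi.smul_apply,
    opN_apply, opT_ascending hτ _ _ (by simp [shift] : shift n 1 x 1 = 0), opN_apply]
  have e : shift n 1 (fun p => if 1 ≤ p ∧ p < 1 + (n - 1) then shift n 1 x (p + 1)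
      else if p = 1 + (n - 1) then 0 else shift n 1 x p) = shift n 1 x := by
    ext p
    simp only [shift_apply le_rfl]
    split_ifs <;> first | rfl | exact congrArg x (by omega) | (exfalso; omega)
  rw [e, if_neg (show ¬(1 ≤ n ∧ n < 1 + (n - 1)) by omega),
    if_pos (show n = 1 + (n - 1) by omega), if_pos hc0, smul_eq_mul, mul_ite, mul_zero]

/-- The eigenvalue of `F_i ^ δ E_i` on two letters with colours `c a` and `c b`. -/
def colourPair (c : ℕ → L) (δ : ℕ) (a b : ℕ) : L :=
  open Classical in if c a = c b then c a ^ δ else 0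

/-- The eigenvalue of `T_i` on two equal letters. -/
def diagEntry (u : L) (c : ℕ → L) (δ : ℕ) (a : ℕ) : L :=
  open Classical in if c a ^ δ = 1 then u else 1

/-- The image of the generators in the representation on functions of words. -/
def repGen (u : L) (c : ℕ → L) (n d : ℕ) : Gen n → Module.End L ((ℕ → ℕ) → L)
  | Gen.T i _ => opT u (colourPair c ((d ^ 2 - d) / 2)) (diagEntry u c ((d ^ 2 - d) / 2)) i
  | Gen.F i _ => opF c i
  | Gen.N => opN c n

theorem opF_pow (c : ℕ → L) (i k : ℕ) : opF c i ^ k = opF (fun a => c a ^ k) i := by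
  induction k with
  | zero => ext f x; simp [opF_apply]
  | succ k ih =>
    ext f x
    rw [pow_succ, ih, Module.End.mul_apply, opF_apply, opF_apply, opF_apply, pow_succ, mul_assoc]

/-- On a pair of colours `E_i` is the projection onto equal ones: for `a ≠ b` the sum times `a - b`
is a multiple of `a ^ d - b ^ d = 0`. -/
theorem sum_colours [CharZero L] {d : ℕ} (hd : 1 ≤ d) {a b : L} (ha : a ^ d = 1) (hb : b ^ d = 1)
    [Decidable (a = b)] :
    (d : L)⁻¹ * ∑ k ∈ Finset.range d, a ^ k * b ^ (d - k) = if a = b then 1 else 0 := by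
  split_ifs with h
  · subst h
    have h1 : ∀ k ∈ Finset.range d, a ^ k * a ^ (d - k) = 1 := fun k hk => by
      rw [← pow_add, Nat.add_sub_cancel' (Finset.mem_range.1 hk).le, ha]
    rw [Finset.sum_congr rfl h1]
    simp [show d ≠ 0 by omega]
  · have h1 := (Commute.all a b).geom_sum₂_mul d
    rw [ha, hb, sub_self, mul_eq_zero, or_iff_left (sub_ne_zero.2 h)] at h1
    have h2 : ∑ k ∈ Finset.range d, a ^ k * b ^ (d - k)
        = b * ∑ k ∈ Finset.range d, a ^ k * b ^ (d - 1 - k) := by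
      rw [Finset.mul_sum]
      refine Finset.sum_congr rfl fun k hk => ?_
      rw [show d - k = d - 1 - k + 1 by have := Finset.mem_range.1 hk; omega, pow_succ]
      ring
    rw [h2, h1, mul_zero, mul_zero]

/-- The square of this power is `(c a ^ d) ^ (d - 1) = 1`. The sign decides which root of the
quadratic equation is used in `diagEntry`: `u` for 1 and `1` for -1, both of which become 1 at `u =
1`. -/
theorem colour_sq {c : ℕ → L} {d : ℕ} (hcd : ∀ a, c a ^ d = 1) (a : ℕ) :
    c a ^ ((d ^ 2 - d) / 2) = 1 ∨ c a ^ ((d ^ 2 - d) / 2) = -1 := by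
  rw [← sq_eq_one_iff, ← pow_mul]
  have h : d ^ 2 - d = d * (d - 1) := by rw [sq, Nat.mul_sub, mul_one]
  rw [Nat.div_mul_cancel (h ▸ (Nat.even_mul_pred_self d).two_dvd), h, pow_mul, hcd, one_pow]

theorem colourPair_symm (c : ℕ → L) (δ a b : ℕ) : colourPair c δ a b = colourPair c δ b a := by
  unfold colourPair
  split_ifs with h1 h2 h2
  · rw [h1]
  · exact absurd h1.symm h2
  · exact absurd h2.symm h1
  · rfl

theorem colourPair_mul (c : ℕ → L) (δ a b e : ℕ) :
    colourPair c δ a b * colourPair c δ b e = colourPair c δ a b * colourPair c δ a e := by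
  unfold colourPair
  by_cases h : c a = c b
  · rw [h]
  · rw [if_neg h, zero_mul, zero_mul]

theorem diagEntry_sq {c : ℕ → L} {d : ℕ} (hcd : ∀ a, c a ^ d = 1) (u : L) (a : ℕ) :
    diagEntry u c ((d ^ 2 - d) / 2) a * diagEntry u c ((d ^ 2 - d) / 2) a
      = u + (u - 1) * colourPair c ((d ^ 2 - d) / 2) a a * diagEntry u c ((d ^ 2 - d) / 2) a := by
  unfold diagEntry colourPair
  rw [if_pos rfl]
  split_ifs with h
  · rw [h]; ring
  · rw [(colour_sq hcd a).resolve_left h]; ring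

variable {K : Type*} [Field K] [Algebra (RatFunc K) L]

/-- The parameters are tuned to the relations: `d`-th roots of unity as colours give `F_i ^ d = 1`,
the pair `g`, `τ` satisfies the quadratic relation, and letters of colour 1 (0 among them) have `τ =
u` and `g = 1`, as the absorption relations with `N` demand. -/
theorem lift_rel [CharZero K] {u : L} (hu : algebraMap (RatFunc K) L RatFunc.X = u) {c : ℕ → L}
    {n d : ℕ} (hn : 1 ≤ n) (hd : 1 ≤ d) (hc0 : c 0 = 1) (hcd : ∀ a, c a ^ d = 1)
    {x y : Free K n} (h : Rel K n d x y) :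
    FreeAlgebra.lift (RatFunc K) (repGen u c n d) x
      = FreeAlgebra.lift (RatFunc K) (repGen u c n d) y := by
  have : CharZero L := by
    have : CharZero (RatFunc K) := charZero_of_injective_algebraMap (algebraMap K (RatFunc K)).injective
    exact charZero_of_injective_algebraMap (algebraMap (RatFunc K) L).injective
  set φ := FreeAlgebra.lift (RatFunc K) (repGen u c n d) with hφ
  set g := colourPair c ((d ^ 2 - d) / 2) with hg
  set τ := diagEntry u c ((d ^ 2 - d) / 2) with hτ
  have φT : ∀ i, 1 ≤ i → i < n → φ (freeT K n i) = opT u g τ i := fun i h1 h2 => by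
    rw [freeT, dif_pos ⟨h1, h2⟩, hφ, FreeAlgebra.lift_ι_apply]; rfl
  have φF : ∀ i, 1 ≤ i → i ≤ n → φ (freeF K n i) = opF c i := fun i h1 h2 => by
    rw [freeF, dif_pos ⟨h1, h2⟩, hφ, FreeAlgebra.lift_ι_apply]; rfl
  have φN : φ (freeN K n) = opN c n := by rw [freeN, hφ, FreeAlgebra.lift_ι_apply]; rfl
  have hsmul : ∀ (r : RatFunc K) (a : Module.End L ((ℕ → ℕ) → L)),
      r • a = algebraMap (RatFunc K) L r • a := fun r a => by
    ext f x
    simp [Algebra.smul_def]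
  have τ1 : ∀ a, c a = 1 → τ a = u := fun a ha => by
    rw [hτ, diagEntry, ha, one_pow, if_pos rfl]
  have g1 : ∀ a b, c a = 1 → c b = 1 → g a b = 1 := fun a b ha hb => by
    rw [hg, colourPair, ha, hb, if_pos rfl, one_pow]
  have hgc : ∀ a b, g a b * c a = g a b * c b := fun a b => by
    rw [hg, colourPair]
    split_ifs with h
    · rw [h]
    · rw [zero_mul, zero_mul]
  cases h with
  | braid i j hi hj hij =>
    simp only [map_mul, φT _ hi.1 hi.2, φT _ hj.1 hj.2]
    have key := opT_braid (u := u) (colourPair_symm c _) (colourPair_mul c _) (diagEntry_sq hcd u)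
    rcases hij with rfl | rfl
    · exact key i
    · exact (key j).symm
  | comm i j hi hj hij =>
    simp only [map_mul, φT _ hi.1 hi.2, φT _ hj.1 hj.2]
    rcases hij with h | h
    · exact opT_comm _ _ _ h
    · exact (opT_comm _ _ _ h).symm
  | F_pow i hi =>
    rw [map_pow, φF i hi.1 hi.2, opF_pow, map_one]
    ext f x
    simp [opF_apply, hcd]
  | F_comm i j hi hj =>
    rw [map_mul, map_mul, φF i hi.1 hi.2, φF j hj.1 hj.2]
    ext f x
    simp only [Module.End.mul_apply, opF_apply]
    ring
  | quadratic i hi =>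
    have hE : φ (freeF K n i ^ ((d ^ 2 - d) / 2) * freeE K n d i)
        = opF (fun a => c a ^ ((d ^ 2 - d) / 2)) i *
          (d : L)⁻¹ • ∑ k ∈ Finset.range d,
            opF (fun a => c a ^ k) i * opF (fun a => c a ^ (d - k)) (i + 1) := by
      rw [map_mul, map_pow, freeE, map_smul, map_sum, hsmul, map_inv₀, map_natCast,
        φF i hi.1 hi.2.le, opF_pow]
      simp only [map_mul, map_pow, φF i hi.1 hi.2.le, φF (i + 1) (by omega) (by omega), opF_pow]
    rw [map_pow, map_add, map_smul, map_mul, AlgHom.commutes, φT i hi.1 hi.2, hE, hsmul, map_sub,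
      map_one, hu, sq]
    ext f x
    have key := opT_sq (u := u) (colourPair_symm c _) (diagEntry_sq hcd u) i f x
    rw [Module.End.mul_apply, key]
    simp only [LinearMap.add_apply, LinearMap.smul_apply, Module.End.mul_apply, Pi.add_apply,
      Pi.smul_apply, opF_apply, LinearMap.sum_apply, Finset.sum_apply, smul_eq_mul]
    classical
    have s := sum_colours hd (hcd (x i)) (hcd (x (i + 1)))
    have e : colourPair c ((d ^ 2 - d) / 2) (x i) (x (i + 1)) = c (x i) ^ ((d ^ 2 - d) / 2) *
        ((d : L)⁻¹ * ∑ k ∈ Finset.range d, c (x i) ^ k * c (x (i + 1)) ^ (d - k)) := by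
      rw [s, colourPair, mul_ite, mul_one, mul_zero]
    simp only [← mul_assoc, ← Finset.sum_mul]
    rw [e]
    have e' : (algebraMap (RatFunc K) (Module.End L ((ℕ → ℕ) → L)) RatFunc.X) f x = u * f x := by
      rw [Algebra.algebraMap_eq_smul_one, hsmul, hu]; rfl
    rw [e']
    ring
  | T_F i j hi hj =>
    have := swap_mem_Icc hi.1 hi.2 hj.1 hj.2
    rw [map_mul, map_mul, φT i hi.1 hi.2, φF j hj.1 hj.2, φF _ this.1 this.2]
    exact opT_mul_opF hgc i j
  | F_N i hi =>
    rw [map_mul, map_mul, φF i hi.1 hi.2.le, φF _ (by omega) hi.2, φN]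
    exact opF_mul_opN c hi.1 hi.2
  | N_F_one =>
    rw [map_mul, φF 1 le_rfl hn, φN, opN_mul_opF_one hc0]
  | F_last_N =>
    rw [map_mul, φF n hn le_rfl, φN, opF_last_mul_opN]
  | N_pow_T i hi =>
    rw [map_mul, map_smul, map_pow, φT i hi.1 hi.2, φN, hsmul, hu]
    exact opN_pow_mul_opT hc0 (τ1 0 hc0) hn
  | T_N_pow i hi =>
    rw [map_mul, map_smul, map_pow, φT i hi.1 hi.2, φN, hsmul, hu]
    exact opT_mul_opN_pow hc0 τ1 g1 hi.1 hi.2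
  | T_N i hi =>
    rw [map_mul, map_mul, φT i hi.1 (by omega), φT _ (by omega) hi.2, φN]
    exact opT_mul_opN _ _ _ _ hi.1 hi.2
  | N_T_N =>
    have e : φ ((List.range' 1 (n - 1)).map (freeT K n)).prod
        = wordProd (opT u g τ) (List.range' 1 (n - 1)) := by
      rw [map_list_prod, List.map_map, wordProd]
      congr 1
      refine List.map_congr_left fun i hi => ?_
      rw [List.mem_range'_1] at hi
      exact φT i hi.1 (by omega)
    rw [map_mul, map_mul, map_smul, φN, e, hsmul, map_pow, hu]
    exact opN_mul_opT_mul_opN (τ1 0 hc0) hc0 hn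

/-- The representation of the Rook Yokonuma--Hecke algebra on functions of words. -/
def rep [CharZero K] {u : L} (hu : algebraMap (RatFunc K) L RatFunc.X = u) {c : ℕ → L}
    {n d : ℕ} (hn : 1 ≤ n) (hd : 1 ≤ d) (hc0 : c 0 = 1) (hcd : ∀ a, c a ^ d = 1) :
    RY K n d →ₐ[RatFunc K] Module.End L ((ℕ → ℕ) → L) :=
  RingQuot.liftAlgHom (RatFunc K) ⟨FreeAlgebra.lift (RatFunc K) (repGen u c n d),
    fun _ _ h => lift_rel hu hn hd hc0 hcd h⟩

section
variable [CharZero K] {u : L} (hu : algebraMap (RatFunc K) L RatFunc.X = u) {c : ℕ → L}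
    {n d : ℕ} (hn : 1 ≤ n) (hd : 1 ≤ d) (hc0 : c 0 = 1) (hcd : ∀ a, c a ^ d = 1)

theorem rep_T {i : ℕ} (hi : 1 ≤ i) (hin : i < n) : rep hu hn hd hc0 hcd (T K n d i)
    = opT u (colourPair c ((d ^ 2 - d) / 2)) (diagEntry u c ((d ^ 2 - d) / 2)) i := by
  rw [rep, T, RingQuot.liftAlgHom_mkAlgHom_apply, freeT, dif_pos ⟨hi, hin⟩,
    FreeAlgebra.lift_ι_apply]
  rfl

theorem rep_F {i : ℕ} (hi : 1 ≤ i) (hin : i ≤ n) :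
    rep hu hn hd hc0 hcd (F K n d i) = opF c i := by
  rw [rep, F, RingQuot.liftAlgHom_mkAlgHom_apply, freeF, dif_pos ⟨hi, hin⟩,
    FreeAlgebra.lift_ι_apply]
  rfl

theorem rep_N : rep hu hn hd hc0 hcd (N K n d) = opN c n := by
  rw [rep, N, RingQuot.liftAlgHom_mkAlgHom_apply, freeN, FreeAlgebra.lift_ι_apply]
  rfl

end

end Representation
end RookYH
end

/-! ### Specialization at u = 1 -/

noncomputable section
namespace RookYH
open Polynomial

/-- A permutation of the positions acting on functions of words. -/
def permAct (k : Type*) (σ : Equiv.Perm ℕ) (f : (ℕ → ℕ) → k) (x : ℕ → ℕ) : k := f (x ∘ σ)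

theorem permAct_mul (k : Type*) (σ τ : Equiv.Perm ℕ) : permAct k (σ * τ) = permAct k σ ∘ permAct k τ := rfl

/-- The transpositions of neighbours in `ℕ`. -/
def swapNat (i : ℕ) : Equiv.Perm ℕ := Equiv.swap i (i + 1)

section Specialization

variable {L k : Type*} [Field L] [Field k] {ι : k[X] →+* L}

/-- The operator `a` preserves functions with values in `k[X]`, and becomes `g` when the
indeterminate is specialized to one. -/
def SpecializesTo (ι : k[X] →+* L) (a : Module.End L ((ℕ → ℕ) → L))
    (g : ((ℕ → ℕ) → k) → (ℕ → ℕ) → k) : Prop :=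
  ∀ f : (ℕ → ℕ) → k[X], ∃ h : (ℕ → ℕ) → k[X], (∀ x, a (fun x => ι (f x)) x = ι (h x)) ∧
    ∀ x, (h x).eval 1 = g (fun x => (f x).eval 1) x

theorem SpecializesTo.one : SpecializesTo ι 1 id := fun f => ⟨f, fun _ => rfl, fun _ => rfl⟩

theorem SpecializesTo.mul {a b : Module.End L ((ℕ → ℕ) → L)} {g g' : ((ℕ → ℕ) → k) → (ℕ → ℕ) → k}
    (ha : SpecializesTo ι a g) (hb : SpecializesTo ι b g') :
    SpecializesTo ι (a * b) (g ∘ g') := by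
  intro f
  obtain ⟨h, h1, h2⟩ := hb f
  obtain ⟨h', h3, h4⟩ := ha h
  refine ⟨h', fun x => ?_, fun x => ?_⟩
  · rw [Module.End.mul_apply, funext h1, h3]
  · rw [h4, funext h2]; rfl

/-- Functions with constant polynomial values realize every function into `k`, and injectivity of
`ι` determines the polynomial values. Hence equal operators over `L` have equal specializations. -/
theorem SpecializesTo.unique (hι : Function.Injective ι) {a : Module.End L ((ℕ → ℕ) → L)}
    {g g' : ((ℕ → ℕ) → k) → (ℕ → ℕ) → k} (h : SpecializesTo ι a g) (h' : SpecializesTo ι a g') :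
    g = g' := by
  ext f x
  obtain ⟨y, h1, h2⟩ := h fun x => Polynomial.C (f x)
  obtain ⟨y', h3, h4⟩ := h' fun x => Polynomial.C (f x)
  simp only [eval_C] at h2 h4
  rw [← h2, ← h4, hι ((h1 x).symm.trans (h3 x))]

/-- At `u = 1` the correction term `(u - 1) g` vanishes and the off-diagonal coefficients are 1. For
equal letters the swap fixes the word, and either choice of diagonal entry becomes 1. -/
theorem specializesTo_opT (c : ℕ → k) (δ i : ℕ) :
    SpecializesTo ι (opT (ι X) (colourPair (fun a => ι (Polynomial.C (c a))) δ)
      (diagEntry (ι X) (fun a => ι (Polynomial.C (c a))) δ) i) (permAct k (swapNat i)) := by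
  intro f
  suffices H : ∀ x, ∃ p : k[X], opT (ι X) (colourPair (fun a => ι (Polynomial.C (c a))) δ)
      (diagEntry (ι X) (fun a => ι (Polynomial.C (c a))) δ) i (fun x => ι (f x)) x = ι p ∧
      p.eval 1 = permAct k (swapNat i) (fun x => (f x).eval 1) x by
    choose h h1 h2 using H
    exact ⟨h, h1, h2⟩
  intro x
  rw [opT_apply, permAct, swapNat]
  rcases lt_trichotomy (x i) (x (i + 1)) with h | h | h
  · exact ⟨X * f (x ∘ Equiv.swap i (i + 1)), by simp [h], by simp⟩
  · have e : x ∘ Equiv.swap i (i + 1) = x := by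
      ext p
      rw [Function.comp_apply, Equiv.swap_apply_def]
      split_ifs with h1 h2
      · rw [h1, h]
      · rw [h2, h]
      · rfl
    rw [e]
    simp only [h, lt_irrefl, if_true, if_false, diagEntry]
    split_ifs
    · exact ⟨X * f x, by simp, by simp⟩
    · exact ⟨f x, by simp, by simp⟩
  · simp only [h.not_gt, h.ne', if_false, colourPair]
    split_ifs
    · exact ⟨f (x ∘ Equiv.swap i (i + 1)) + (X - 1) * Polynomial.C (c (x i)) ^ δ * f x, by simp, by simp⟩
    · exact ⟨f (x ∘ Equiv.swap i (i + 1)), by simp, by simp⟩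

theorem specializesTo_opF_pow (c : ℕ → k) (i e : ℕ) :
    SpecializesTo ι (opF (fun a => ι (Polynomial.C (c a))) i ^ e) fun f x => c (x i) ^ e * f x := by
  intro f
  refine ⟨fun x => Polynomial.C (c (x i)) ^ e * f x, fun x => ?_, fun x => by simp⟩
  simp [opF_pow, opF_apply]

open Classical in
theorem specializesTo_opN_pow (hι : Function.Injective ι) {c : ℕ → k} (hc0 : c 0 = 1) {n : ℕ}
    (hn : 1 ≤ n) (m : ℕ) :
    SpecializesTo ι (opN (fun a => ι (Polynomial.C (c a))) n ^ m) fun f x =>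
      if ∀ p, 1 ≤ p → n < p + m → p ≤ n → c (x p) = 1 then f (shift n m x) else 0 := by
  intro f
  refine ⟨fun x => if ∀ p, 1 ≤ p → n < p + m → p ≤ n → c (x p) = 1 then f (shift n m x) else 0,
    fun x => ?_, fun x => ?_⟩
  · have h : ∀ a, ι (Polynomial.C (c a)) = 1 ↔ c a = 1 := fun a => by
      rw [← map_one ι, hι.eq_iff, ← C_1, C_inj]
    rw [opN_pow_apply (by rw [hc0, C_1, map_one]) hn]
    simp only [h]
    split_ifs <;> simp
  · beta_reduce
    split_ifs <;> simp

end Specialization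

/-! ### The partial permutation of a standard element -/

section Positions

theorem seg_swapNat {l j : ℕ} (h : j ≤ l) : seg swapNat l j j = l ∧
    ∀ p, p < j ∨ l < p → seg swapNat l j p = p := by
  induction l, h using Nat.le_induction with
  | base => simp
  | succ l h ih =>
    rw [seg_succ _ h]
    refine ⟨?_, fun p hp => ?_⟩
    · rw [Equiv.Perm.mul_apply, ih.1, swapNat, Equiv.swap_apply_left]
    · rw [Equiv.Perm.mul_apply, ih.2 p (by omega), swapNat,
        Equiv.swap_apply_of_ne_of_ne (by omega) (by omega)]

/-- The segment for `a` sends the place `l + 1` to `a` and fixes everything above `a`; later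
segments act first, and the larger entries they produce are left alone. -/
theorem lowProd_swapNat {l n : ℕ} {as : List ℕ} (h : IncrIn l n as) :
    (∀ p ≤ l, lowProd swapNat l as p = p) ∧
      ∀ (i : ℕ) (hi : i < as.length), lowProd swapNat l as (l + 1 + i) = as[i] := by
  induction as generalizing l with
  | nil => simp [lowProd]
  | cons a as ih =>
    obtain ⟨h1, h2, h3⟩ := IncrIn.cons_iff.1 h
    obtain ⟨ih1, ih2⟩ := ih (h3.mono h1)
    have hs := seg_swapNat (show l + 1 ≤ a from h1)
    simp only [lowProd, Equiv.Perm.mul_apply]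
    refine ⟨fun p hp => ?_, fun i hi => ?_⟩
    · rw [ih1 p (by omega), hs.2 p (by omega)]
    · cases i with
      | zero => rw [add_zero, ih1 _ le_rfl, hs.1]; rfl
      | succ i =>
        rw [List.length_cons] at hi
        rw [show l + 1 + (i + 1) = l + 1 + 1 + i by omega, ih2 i (by omega),
          hs.2 _ (Or.inr (h3.2 _ (List.getElem_mem _)).1), List.getElem_cons_succ]

/-- With `l + bs.length = n` the list is just long enough that its first entry is at most `l + 1`,
so each segment really moves `b` up to its target. Later segments act first and fix `b`. -/
theorem highProd_swapNat {l m n : ℕ} {bs : List ℕ} (h : IncrIn m n bs) (hl : l + bs.length = n) :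
    (∀ p, p ≤ m ∨ n < p → highProd swapNat l bs p = p) ∧
      ∀ (i : ℕ) (hi : i < bs.length), highProd swapNat l bs bs[i] = l + 1 + i := by
  induction bs generalizing l m with
  | nil => simp [highProd]
  | cons b bs ih =>
    obtain ⟨h1, h2, h3⟩ := IncrIn.cons_iff.1 h
    rw [List.length_cons] at hl
    obtain ⟨ih1, ih2⟩ := ih (l := l + 1) h3 (by omega)
    have hlen := h3.length_le
    have hs := seg_swapNat (show b ≤ l + 1 by omega)
    simp only [highProd, Equiv.Perm.mul_apply]
    refine ⟨fun p hp => ?_, fun i hi => ?_⟩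
    · rw [ih1 p (by omega), hs.2 p (by omega)]
    · cases i with
      | zero => rw [List.getElem_cons_zero, ih1 b (by omega), hs.1, add_zero]
      | succ i =>
        rw [List.getElem_cons_succ, ih2 i _, hs.2 _ (by omega)]
        omega

theorem wordProd_swapNat {r : ℕ} (l : List (Fin (r - 1))) :
    (∀ p : Fin r, wordProd swapNat (l.map fun i : Fin (r - 1) => (i : ℕ) + 1) (p + 1)
      = (l.map (simple r)).prod p + 1) ∧
    ∀ p, r < p → wordProd swapNat (l.map fun i : Fin (r - 1) => (i : ℕ) + 1) p = p := by
  induction l with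
  | nil => simp [wordProd]
  | cons a l ih =>
    have e : wordProd swapNat ((a :: l).map fun i : Fin (r - 1) => (i : ℕ) + 1)
        = swapNat (a + 1) * wordProd swapNat (l.map fun i : Fin (r - 1) => (i : ℕ) + 1) := by
      simp [wordProd]
    rw [e]
    refine ⟨fun p => ?_, fun p hp => ?_⟩
    · rw [Equiv.Perm.mul_apply, ih.1, List.map_cons, List.prod_cons, Equiv.Perm.mul_apply]
      generalize (l.map (simple r)).prod p = q
      simp only [swapNat, simple, Equiv.swap_apply_def, Fin.ext_iff]
      split_ifs <;> simp_all
    · rw [Equiv.Perm.mul_apply, ih.2 p hp, swapNat,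
        Equiv.swap_apply_of_ne_of_ne (by omega) (by omega)]

theorem incrIn_sort {n : ℕ} {A : Finset ℕ} (h : A ⊆ Finset.Icc 1 n) : IncrIn 0 n A.sort :=
  ⟨A.sortedLT_sort.pairwise, fun a ha => by
    have := Finset.mem_Icc.1 (h ((Finset.mem_sort _).1 ha)); omega⟩

/-- The permutation of positions that belongs to `T_ω`. -/
def posPerm {r : ℕ} (ω : Equiv.Perm (Fin r)) : Equiv.Perm ℕ :=
  wordProd swapNat ((exists_isReducedExpr ω).choose.map fun i : Fin (r - 1) => (i : ℕ) + 1)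

theorem posPerm_succ {r : ℕ} (ω : Equiv.Perm (Fin r)) (p : Fin r) :
    posPerm ω (p + 1) = ω p + 1 := by
  rw [posPerm, (wordProd_swapNat _).1, (exists_isReducedExpr ω).choose_spec.1]

theorem posPerm_of_lt {r : ℕ} (ω : Equiv.Perm (Fin r)) {p : ℕ} (hp : r < p) :
    posPerm ω p = p := (wordProd_swapNat _).2 p hp

/-- The word to which a standard element sends the word `1, 2, …, n`. -/
def standardWord (n : ℕ) {r : ℕ} (A B : Finset ℕ) (ω : Equiv.Perm (Fin r)) : ℕ → ℕ :=
  shift n (n - r) (⇑(lowProd swapNat 0 A.sort) ∘ ⇑(posPerm ω)) ∘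
    ⇑(highProd swapNat (n - r) B.sort)

variable {n r : ℕ} {A B : Finset ℕ}

theorem lowProd_sort (hA : A ⊆ Finset.Icc 1 n) (hAr : A.card = r) (i : Fin r) :
    lowProd swapNat 0 A.sort (i + 1) = A.orderEmbOfFin hAr i := by
  have := (lowProd_swapNat (incrIn_sort hA)).2 i (by simp [hAr])
  rw [zero_add, add_comm] at this
  rw [this, Finset.orderEmbOfFin_apply, Fin.getElem_fin]

theorem standardWord_orderEmb (hA : A ⊆ Finset.Icc 1 n) (hB : B ⊆ Finset.Icc 1 n)
    (hAr : A.card = r) (hBr : B.card = r) (hr : r ≤ n) (ω : Equiv.Perm (Fin r)) (i : Fin r) :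
    standardWord n A B ω (B.orderEmbOfFin hBr i) = A.orderEmbOfFin hAr (ω i) := by
  have := (highProd_swapNat (l := n - r) (incrIn_sort hB) (by simp [hBr]; omega)).2 i
    (by simp [hBr])
  rw [standardWord, Function.comp_apply, Finset.orderEmbOfFin_apply, Fin.getElem_fin,
    this, shift,
    if_pos (by omega), show n - r + 1 + i - (n - r) = i + 1 by omega, Function.comp_apply,
    posPerm_succ, lowProd_sort hA hAr]

/-- The permutation for `B` preserves `1, …, n` and carries `B` onto the last `r` places, so `p`
goes to one of the first `n - r` places, which the shift fills with zeros. -/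
theorem standardWord_of_notMem (hB : B ⊆ Finset.Icc 1 n) (hBr : B.card = r) (hr : r ≤ n)
    (ω : Equiv.Perm (Fin r)) {p : ℕ} (hp : 1 ≤ p) (hpn : p ≤ n) (hpB : p ∉ B) :
    standardWord n A B ω p = 0 := by
  obtain ⟨h1, h2⟩ := highProd_swapNat (l := n - r) (incrIn_sort hB) (by simp [hBr]; omega)
  set σ := highProd swapNat (n - r) B.sort with hσ
  have h3 : σ p ≤ n := by
    by_contra h
    have := σ.injective (h1 (σ p) (Or.inr (by omega)))
    omega
  have h4 : σ p ≤ n - r := by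
    by_contra h
    have h5 := h2 (σ p - (n - r) - 1) (by simp [hBr]; omega)
    rw [show n - r + 1 + (σ p - (n - r) - 1) = σ p by omega] at h5
    exact hpB ((Finset.mem_sort (· ≤ ·)).1 (σ.injective h5 ▸ List.getElem_mem _))
  have h5 : σ p ≠ 0 := fun h => by
    have := σ.injective (h.trans (h1 0 (Or.inl le_rfl)).symm)
    omega
  rw [standardWord, Function.comp_apply, ← hσ, shift, if_neg (by omega)]

/-- The word has nonzero letters exactly at the places in `B`, the set of these letters is `A`, and
their order of appearance is `ω`. -/
theorem standardWord_injective {r' : ℕ} {A' B' : Finset ℕ} (hA : A ⊆ Finset.Icc 1 n)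
    (hB : B ⊆ Finset.Icc 1 n) (hAr : A.card = r) (hBr : B.card = r) (hr : r ≤ n)
    (hA' : A' ⊆ Finset.Icc 1 n) (hB' : B' ⊆ Finset.Icc 1 n) (hAr' : A'.card = r')
    (hBr' : B'.card = r') (hr' : r' ≤ n) (ω : Equiv.Perm (Fin r)) (ω' : Equiv.Perm (Fin r'))
    (h : standardWord n A B ω = standardWord n A' B' ω') : A = A' ∧ B = B' ∧ r = r' ∧ HEq ω ω' := by
  have key : ∀ {r : ℕ} {A B : Finset ℕ} (ω : Equiv.Perm (Fin r)), A ⊆ Finset.Icc 1 n →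
      B ⊆ Finset.Icc 1 n → A.card = r → B.card = r → r ≤ n →
      B = {p ∈ Finset.Icc 1 n | standardWord n A B ω p ≠ 0} := by
    intro r A B ω hA hB hAr hBr hr
    ext p
    rw [Finset.mem_filter]
    refine ⟨fun hp => ⟨hB hp, ?_⟩, fun ⟨hp, h0⟩ => ?_⟩
    · obtain ⟨i, rfl⟩ : p ∈ Set.range (B.orderEmbOfFin hBr) := by
        rw [Finset.range_orderEmbOfFin]; exact hp
      rw [standardWord_orderEmb hA hB hAr hBr hr]
      have := Finset.mem_Icc.1 (hA (A.orderEmbOfFin_mem hAr (ω i)))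
      omega
    · by_contra hpB
      rw [Finset.mem_Icc] at hp
      exact h0 (standardWord_of_notMem hB hBr hr ω hp.1 hp.2 hpB)
  have hBB : B = B' := by
    rw [key ω hA hB hAr hBr hr, key ω' hA' hB' hAr' hBr' hr', h]
  subst hBB
  obtain rfl : r = r' := hBr.symm.trans hBr'
  have hω : ∀ i, A.orderEmbOfFin hAr (ω i) = A'.orderEmbOfFin hAr' (ω' i) := fun i => by
    rw [← standardWord_orderEmb hA hB hAr hBr hr, h, standardWord_orderEmb hA' hB hAr' hBr hr]
  have hAA : A = A' := by
    rw [← Finset.coe_inj, ← Finset.range_orderEmbOfFin A hAr, ← Finset.range_orderEmbOfFin A' hAr',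
      ← ω.surjective.range_comp (A.orderEmbOfFin hAr),
      ← ω'.surjective.range_comp (A'.orderEmbOfFin hAr')]
    exact congrArg Set.range (_root_.funext hω)
  subst hAA
  refine ⟨rfl, rfl, rfl, heq_of_eq (Equiv.ext fun i => (A.orderEmbOfFin hAr).injective (hω i))⟩

end Positions

/-! ### Distinctness of the standard elements and counting -/

section Distinct

variable {K L k : Type*} [Field K] [CharZero K] [Field L] [Field k] [Algebra (RatFunc K) L]
  {ι : k[X] →+* L} {n d : ℕ}

/-- The value of a standard element at the word `1, 2, …, n`, after specialization. -/
theorem specialize_standard (hι : Function.Injective ι)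
    (hu : algebraMap (RatFunc K) L RatFunc.X = ι X) (hn : 1 ≤ n) (hd : 1 ≤ d) {c : ℕ → k}
    (hc0 : ι (Polynomial.C (c 0)) = 1) (hcd : ∀ a, ι (Polynomial.C (c a)) ^ d = 1) {r : ℕ} {A B : Finset ℕ}
    (hA : A ⊆ Finset.Icc 1 n) (hB : B ⊆ Finset.Icc 1 n) (hAr : A.card = r) (hBr : B.card = r)
    (hr : r ≤ n) (hcA : ∀ a, a ∉ A → c a = 1) (m : Fin r → ZMod d) (ω : Equiv.Perm (Fin r)) :
    ∃ g, SpecializesTo ι (rep (c := fun a => ι (Polynomial.C (c a))) hu hn hd hc0 hcd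
        (TA K n d A * Fm K n d m * Tperm K n d ω * N K n d ^ (n - r) * TAbar K n d B)) g ∧
      ∀ f, g f id = (∏ i, c (A.orderEmbOfFin hAr i) ^ (m i).val) * f (standardWord n A B ω) := by
  classical
  set ρ := rep (c := fun a => ι (Polynomial.C (c a))) hu hn hd hc0 hcd with hρ
  have hc0' : c 0 = 1 := by rwa [← map_one ι, hι.eq_iff, ← C_1, C_inj] at hc0
  have hw : ∀ w : List ℕ, (∀ i ∈ w, 1 ≤ i ∧ i < n) →
      SpecializesTo ι (ρ (wordProd (T K n d) w)) (permAct k (wordProd swapNat w)) := by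
    intro w hw
    induction w with
    | nil =>
      simp only [wordProd, List.map_nil, List.prod_nil, map_one]
      exact SpecializesTo.one
    | cons i w ih =>
      have h1 : wordProd (T K n d) (i :: w) = T K n d i * wordProd (T K n d) w := by
        simp [wordProd]
      have h2 : wordProd swapNat (i :: w) = swapNat i * wordProd swapNat w := by simp [wordProd]
      obtain ⟨hi, hin⟩ := hw i (by simp)
      rw [h1, h2, map_mul, permAct_mul, hρ, rep_T hu hn hd hc0 hcd hi hin]
      exact (specializesTo_opT c _ i).mul (ih fun j hj => hw j (by simp [hj]))
  have hseg : ∀ l j, 1 ≤ j → l ≤ n →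
      SpecializesTo ι (ρ (seg (T K n d) l j)) (permAct k (seg swapNat l j)) := fun l j hj hl =>
    hw _ fun i hi => by simp only [List.mem_reverse, List.mem_range'_1] at hi; omega
  have hlow : ∀ as l, IncrIn l n as →
      SpecializesTo ι (ρ (lowProd (T K n d) l as)) (permAct k (lowProd swapNat l as)) := by
    intro as
    induction as with
    | nil => intro l _; simp only [lowProd, map_one]; exact SpecializesTo.one
    | cons a as ih =>
      intro l h
      obtain ⟨h1, h2, h3⟩ := IncrIn.cons_iff.1 h
      rw [lowProd, lowProd, map_mul, permAct_mul]
      exact (hseg _ _ (by omega) h2).mul (ih _ (h3.mono h1))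
  have hhigh : ∀ bs l, IncrIn 0 n bs → l + bs.length ≤ n →
      SpecializesTo ι (ρ (highProd (T K n d) l bs)) (permAct k (highProd swapNat l bs)) := by
    intro bs
    induction bs with
    | nil => intro l _ _; simp only [highProd, map_one]; exact SpecializesTo.one
    | cons b bs ih =>
      intro l h hl
      obtain ⟨h1, h2, h3⟩ := IncrIn.cons_iff.1 h
      rw [List.length_cons] at hl
      rw [highProd, highProd, map_mul, permAct_mul]
      exact (hseg _ _ h1 (by omega)).mul (ih _ (h3.mono (by omega)) (by omega))
  have hF : ∀ (r : ℕ) (m : Fin r → ZMod d), r ≤ n → SpecializesTo ι (ρ (Fm K n d m))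
      fun f x => (∏ i : Fin r, c (x (i + 1)) ^ (m i).val) * f x := by
    intro r
    induction r with
    | zero => intro m _; simp only [Fm, List.ofFn_zero, List.prod_nil, map_one,
        Finset.univ_eq_empty, Finset.prod_empty, one_mul]; exact SpecializesTo.one
    | succ r ih =>
      intro m hr
      have h1 := (ih (Fin.init m) (by omega)).mul
        (specializesTo_opF_pow (ι := ι) c (r + 1) (m (Fin.last r)).val)
      rw [← rep_F hu hn hd hc0 hcd (by omega) hr, ← map_pow, ← map_mul, ← Fm_snoc,
        Fin.snoc_init_self] at h1
      convert h1 using 1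
      ext f x
      rw [Function.comp_apply, Fin.prod_univ_castSucc]
      simp [Fin.init, mul_assoc]
  have hT : SpecializesTo ι (ρ (Tperm K n d ω)) (permAct k (posPerm ω)) := by
    have e : Tperm K n d ω = wordProd (T K n d)
        ((exists_isReducedExpr ω).choose.map fun i : Fin (r - 1) => (i : ℕ) + 1) := by
      rw [Tperm, wordProd, List.map_map]
      simp only [bind_pure_comp, List.map_eq_map, List.map_map]
      rfl
    rw [e]
    refine hw _ fun i hi => ?_
    obtain ⟨j, -, rfl⟩ := List.mem_map.1 hi
    omega
  have hN := specializesTo_opN_pow (ι := ι) hι hc0' hn (n - r)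
  rw [← rep_N hu hn hd hc0 hcd, ← map_pow, ← hρ] at hN
  have hlA := hlow _ 0 (incrIn_sort hA)
  have hhB := hhigh _ (n - r) (incrIn_sort hB) (by simp [hBr]; omega)
  rw [← TA_eq] at hlA
  rw [← hBr, ← TAbar_eq, hBr] at hhB
  have tot := (((hlA.mul (hF r m hr)).mul hT).mul hN).mul hhB
  simp only [← map_mul] at tot
  refine ⟨_, tot, fun f => ?_⟩
  simp only [Function.comp_apply, permAct, Function.id_comp]
  rw [if_pos]
  · rw [standardWord]
    congr 1
    exact Finset.prod_congr rfl fun i _ => by rw [lowProd_sort hA hAr, id]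
  -- The letters tested by `N ^ (n - r)` stand at places above `r`. The first `r` places carry all
  -- of `A`, so these letters lie outside `A` and have colour 1.
  · intro p hp h1 h2
    refine hcA _ fun hmem => ?_
    rw [posPerm_of_lt ω (by omega)] at hmem
    have : lowProd swapNat 0 A.sort p ∈ Set.range (A.orderEmbOfFin hAr) := by
      rw [Finset.range_orderEmbOfFin]; exact hmem
    obtain ⟨i, hi⟩ := this
    rw [← lowProd_sort hA hAr] at hi
    have := (lowProd swapNat 0 A.sort).injective hi
    omega

-- Enlarging the constants, here to an algebraic closure, makes a primitive `d`-th root of unity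
-- available as a colour while the indeterminate stays the same.
omit [CharZero K] in
theorem exists_specialization (K : Type*) [Field K] (k : Type*) [Field k] [Algebra K k] :
    ∃ j : RatFunc K →+* RatFunc k, j RatFunc.X = algebraMap k[X] (RatFunc k) X := by
  have hinj : Function.Injective
      ((algebraMap k[X] (RatFunc k)).comp (Polynomial.mapRingHom (algebraMap K k))) :=
    (RatFunc.algebraMap_injective k).comp (Polynomial.map_injective _ (algebraMap K k).injective)
  refine ⟨IsFractionRing.lift (A := K[X]) hinj, ?_⟩
  rw [← RatFunc.algebraMap_X, IsFractionRing.lift_algebraMap]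
  simp

/-- The elements of `C_n` are determined by their parameters. -/
theorem eq_of_standard_eq (hn : 1 ≤ n) (hd : 1 ≤ d) {r r' : ℕ} {A B A' B' : Finset ℕ}
    (hA : A ⊆ Finset.Icc 1 n) (hB : B ⊆ Finset.Icc 1 n) (hAr : A.card = r) (hBr : B.card = r)
    (hr : r ≤ n) (hA' : A' ⊆ Finset.Icc 1 n) (hB' : B' ⊆ Finset.Icc 1 n) (hAr' : A'.card = r')
    (hBr' : B'.card = r') (hr' : r' ≤ n) {m : Fin r → ZMod d} {m' : Fin r' → ZMod d}
    {ω : Equiv.Perm (Fin r)} {ω' : Equiv.Perm (Fin r')}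
    (h : TA K n d A * Fm K n d m * Tperm K n d ω * N K n d ^ (n - r) * TAbar K n d B
      = TA K n d A' * Fm K n d m' * Tperm K n d ω' * N K n d ^ (n - r') * TAbar K n d B') :
    A = A' ∧ B = B' ∧ r = r' ∧ HEq m m' ∧ HEq ω ω' := by
  classical
  have : NeZero d := ⟨by omega⟩
  obtain ⟨j, hj⟩ := exists_specialization K (AlgebraicClosure K)
  let := j.toAlgebra
  have hu : algebraMap (RatFunc K) (RatFunc (AlgebraicClosure K)) RatFunc.X
    = algebraMap (AlgebraicClosure K)[X] (RatFunc (AlgebraicClosure K)) X := hj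
  have hι := RatFunc.algebraMap_injective (AlgebraicClosure K)
  -- With all colours equal to 1 the exponents are invisible and only the standard word remains; an
  -- indicator function of that word separates the parameters `A`, `B` and `ω`.
  have step1 : A = A' ∧ B = B' ∧ r = r' ∧ HEq ω ω' := by
    obtain ⟨g, hg, hgf⟩ := specialize_standard (c := fun _ => (1 : AlgebraicClosure K)) hι hu hn hd
      (by simp) (by simp) hA hB hAr hBr hr (fun _ _ => rfl) m ω
    obtain ⟨g', hg', hgf'⟩ := specialize_standard (c := fun _ => (1 : AlgebraicClosure K)) hι hu
      hn hd (by simp) (by simp) hA' hB' hAr' hBr' hr' (fun _ _ => rfl) m' ω'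
    rw [h] at hg
    obtain rfl := hg.unique hι hg'
    refine standardWord_injective hA hB hAr hBr hr hA' hB' hAr' hBr' hr' ω ω' ?_
    by_contra hz
    have := (hgf (Pi.single (standardWord n A B ω) 1)).symm.trans (hgf' _)
    rw [Pi.single_eq_same, Pi.single_eq_of_ne (Ne.symm hz)] at this
    simp at this
  obtain ⟨rfl, rfl, rfl, hω⟩ := step1
  obtain rfl := eq_of_heq hω
  refine ⟨rfl, rfl, rfl, heq_of_eq ?_, HEq.rfl⟩
  ext i
  obtain ⟨ζ, hζ⟩ := HasEnoughRootsOfUnity.exists_primitiveRoot (AlgebraicClosure K) d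
  set a := A.orderEmbOfFin hAr i with ha
  have haA : a ∈ A := A.orderEmbOfFin_mem hAr i
  have ha0 : a ≠ 0 := by have := Finset.mem_Icc.1 (hA haA); omega
  set c : ℕ → AlgebraicClosure K := fun b => if b = a then ζ else 1 with hc
  have hc0 : c 0 = 1 := by simp [hc, ha0.symm]
  have hcd : ∀ b, c b ^ d = 1 := fun b => by
    simp only [hc]; split_ifs
    · exact hζ.pow_eq_one
    · exact one_pow d
  -- Only the letter `a` of `A` gets the colour `ζ`. Tested on the constant function 1, the element
  -- then returns `ζ ^ (m i).val`.
  have hcA : ∀ b, b ∉ A → c b = 1 := fun b hb => if_neg fun e : b = a => hb (e ▸ haA)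
  have h0 : algebraMap (AlgebraicClosure K)[X] (RatFunc (AlgebraicClosure K))
      (Polynomial.C (c 0)) = 1 := by rw [hc0, C_1, map_one]
  have h1 : ∀ b, algebraMap (AlgebraicClosure K)[X] (RatFunc (AlgebraicClosure K))
      (Polynomial.C (c b)) ^ d = 1 := fun b => by
    rw [← map_pow, ← C_pow, hcd, C_1, map_one]
  obtain ⟨g, hg, hgf⟩ := specialize_standard (c := c) hι hu hn hd h0 h1 hA hB hAr hBr hr hcA m ω
  obtain ⟨g', hg', hgf'⟩ := specialize_standard (c := c) hι hu hn hd h0 h1 hA hB hAr hBr hr hcA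
    m' ω
  rw [h] at hg
  obtain rfl := hg.unique hι hg'
  have hprod : ∀ q : Fin r → ZMod d,
      ∏ l, c (A.orderEmbOfFin hAr l) ^ (q l).val = ζ ^ (q i).val := fun q => by
    rw [Finset.prod_eq_single i]
    · simp [hc, ha]
    · intro l _ hl
      have : A.orderEmbOfFin hAr l ≠ a := fun e => hl ((A.orderEmbOfFin hAr).injective e)
      simp [hc, this]
    · simp
  have := (hgf fun _ => 1).symm.trans (hgf' _)
  rw [hprod, hprod, mul_one, mul_one] at this
  exact ZMod.val_injective d (hζ.pow_inj (ZMod.val_lt _) (ZMod.val_lt _) this)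

/-- The parameters of the elements of `C_{n,r}`. -/
def indexSet (n d r : ℕ) [NeZero d] :
    Finset (Finset ℕ × Finset ℕ × (Fin r → ZMod d) × Equiv.Perm (Fin r)) :=
  (Finset.Icc 1 n).powersetCard r ×ˢ (Finset.Icc 1 n).powersetCard r ×ˢ Finset.univ ×ˢ Finset.univ

theorem card_indexSet (n d r : ℕ) [NeZero d] :
    (indexSet n d r).card = d ^ r * n.choose r ^ 2 * r.factorial := by
  simp only [indexSet, Finset.card_product, Finset.card_powersetCard, Nat.card_Icc,
    Finset.card_univ, Fintype.card_pi, ZMod.card, Finset.prod_const, Fintype.card_fin,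
    Fintype.card_perm, Nat.add_sub_cancel]
  ring

theorem Cr_eq_image (K : Type*) [Field K] (n d r : ℕ) [NeZero d] :
    Cr K n d r = (fun p : Finset ℕ × Finset ℕ × (Fin r → ZMod d) × Equiv.Perm (Fin r) =>
      TA K n d p.1 * Fm K n d p.2.2.1 * Tperm K n d p.2.2.2 * N K n d ^ (n - r) *
        TAbar K n d p.2.1) '' indexSet n d r := by
  ext x
  simp only [Cr, Set.mem_ofPred_eq, Set.mem_image, Finset.mem_coe, indexSet, Finset.mem_product,
    Finset.mem_powersetCard, Finset.mem_univ, and_true]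
  constructor
  · rintro ⟨A, B, hA, hB, hAr, hBr, m, ω, rfl⟩
    exact ⟨(A, B, m, ω), ⟨⟨hA, hAr⟩, hB, hBr⟩, rfl⟩
  · rintro ⟨⟨A, B, m, ω⟩, ⟨⟨hA, hAr⟩, hB, hBr⟩, rfl⟩
    exact ⟨A, B, hA, hB, hAr, hBr, m, ω, rfl⟩

theorem finite_Cr (K : Type*) [Field K] (n d r : ℕ) [NeZero d] : (Cr K n d r).Finite := by
  rw [Cr_eq_image]
  exact (indexSet n d r).finite_toSet.image _

theorem ncard_Cr (K : Type*) [Field K] [CharZero K] {n d r : ℕ} (hn : 1 ≤ n) [NeZero d]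
    (hr : r ≤ n) : (Cr K n d r).ncard = d ^ r * n.choose r ^ 2 * r.factorial := by
  rw [Cr_eq_image, Set.InjOn.ncard_image, Set.ncard_coe_finset, card_indexSet]
  rintro ⟨A, B, m, ω⟩ hp ⟨A', B', m', ω'⟩ hp' h
  simp only [indexSet, Finset.mem_coe, Finset.mem_product, Finset.mem_powersetCard] at hp hp'
  obtain ⟨h1, h2, -, h3, h4⟩ := eq_of_standard_eq hn (NeZero.one_le) hp.1.1 hp.2.1.1 hp.1.2
    hp.2.1.2 hr hp'.1.1 hp'.2.1.1 hp'.1.2 hp'.2.1.2 hr h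
  exact Prod.ext h1 (Prod.ext h2 (Prod.ext (eq_of_heq h3) (eq_of_heq h4)))

theorem pairwiseDisjoint_Cr (K : Type*) [Field K] [CharZero K] {n d : ℕ} (hn : 1 ≤ n)
    (hd : 1 ≤ d) : (Finset.range (n + 1) : Set ℕ).PairwiseDisjoint (Cr K n d) := by
  intro r hr r' hr' hne
  rw [Finset.mem_coe, Finset.mem_range] at hr hr'
  refine Set.disjoint_left.2 ?_
  rintro _ ⟨A, B, hA, hB, hAr, hBr, m, ω, rfl⟩ ⟨A', B', hA', hB', hAr', hBr', m', ω', h⟩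
  exact hne (eq_of_standard_eq hn hd hA hB hAr hBr (by omega) hA' hB' hAr' hBr' (by omega) h).2.2.1

end Distinct
end RookYH
end

theorem mainTheorem4 (K : Type*) [Field K] [CharZero K] (n d : ℕ) (hn : 1 ≤ n) (hd : 1 ≤ d) :
    Submodule.span (RatFunc K) (RookYH.C K n d) = ⊤ ∧
    Module.rank (RatFunc K) (RookYH.RY K n d) ≤ Cardinal.mk (RookYH.C K n d) ∧
    (Finset.range (n + 1) : Set ℕ).PairwiseDisjoint (RookYH.Cr K n d) ∧
    (∀ r ≤ n, (RookYH.Cr K n d r).ncard = d ^ r * n.choose r ^ 2 * r.factorial) ∧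
    (RookYH.C K n d).Finite ∧
    (RookYH.C K n d).ncard = ∑ r ∈ Finset.range (n + 1), d ^ r * n.choose r ^ 2 * r.factorial := by
  have : NeZero d := ⟨by omega⟩
  have hspan := RookYH.span_C (K := K) hn hd
  have hfin : ∀ r ∈ Finset.range (n + 1), (RookYH.Cr K n d r).Finite := fun r _ =>
    RookYH.finite_Cr K n d r
  refine ⟨hspan, ?_, RookYH.pairwiseDisjoint_Cr K hn hd, fun r hr => RookYH.ncard_Cr K hn hr,
    (Finset.range (n + 1)).finite_toSet.biUnion hfin, ?_⟩
  · rw [← rank_top, ← hspan]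
    exact rank_span_le _
  · classical
    have hC : RookYH.C K n d = ↑((Finset.range (n + 1)).biUnion fun r =>
        (RookYH.finite_Cr K n d r).toFinset) := by
      simp [RookYH.C]
    rw [hC, Set.ncard_coe_finset, Finset.card_biUnion]
    · refine Finset.sum_congr rfl fun r hr => ?_
      rw [← Set.ncard_eq_toFinset_card _ (RookYH.finite_Cr K n d r),
        RookYH.ncard_Cr K hn (by simpa [Nat.lt_succ_iff] using hr)]
    · intro r hr r' hr' hne
      exact Set.Finite.disjoint_toFinset.2 (RookYH.pairwiseDisjoint_Cr K hn hd hr hr' hne)
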